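/- **Model.** Let $G$ be a finite connected undirected simple graph with $n$ nodes and radius $R$. Nodes are unlabelled; at each node $v$ the incident edges carry the distinct port numbers $0,\dots,\deg(v)-1$, arbitrarily and independently at the two ends of an edge. A team of $m$ robots is placed at arbitrary nodes. In each round every robot shows an ID (a natural number). Exactly $f$ robots are strongly Byzantine: in every round each of them shows an arbitrary ID, and then stays or moves to an arbitrary neighbouring node, as an adversary decides. The others are non-faulty, with fixed pairwise distinct IDs; each initially knows only its own ID and the visibility range $H$. All non-faulty robots start in round $0$ and execute the same deterministic algorithm synchronously. In each round a robot at $v$ sees (i) its *local view*: $\deg(v)$, the multiset of IDs at $v$, and the port by which it has just entered $v$; (ii) its *snapshot*: the subgraph induced by the nodes at distance at most $H$ from $v$, with all port numbers of its edges and the multiset of IDs at each of its nodes. A robot recognises the same node in its different snapshots (through private names unrelated to those of other robots), but is not told at which node of the snapshot it is. It then stays, moves through a port of its choice, or terminates. **The H-View-Algorithm** (robot $\alpha$ with ID $l_\alpha$). The *candidates* in a snapshot are the nodes having the same degree and the same multiset of IDs as the local view. 1. *Find-Lookout.* For each candidate $w$ in the initial snapshot $S_0$, compute the port sequence of a depth-first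 traversal of $S_0$ starting at $w$, follow it in the network until it ends or the next port does not exist, and return by reversing the steps. In each round of each attempt count the nodes in the snapshot; remember the maximum $n_{\max}$, a port sequence from the starting node to a node $v_{\max}$ where it was witnessed, and the number $m_{\max}$ of robots seen there. Then go to $v_{\max}$, wait until round $(m_{\max}+2)n_{\max}^2$, let $P_\alpha$ be the set of candidates in the snapshot of this round, and set $phase:=1$. 2. *March-to-Center*, $H$ rounds. If $P_\alpha=\{v_0\}$, move along a shortest path of the snapshot from $v_0$ to a closest node $c$ of the center of the snapshot (the nodes of minimum eccentricity), wait for the rest of the $H$ rounds, and set $P_\alpha:=\{c\}$. Otherwise stay, and in each of the rounds from the first to the end of the waiting period inclusive remove from $P_\alpha$ all nodes at which the ID $l_\alpha$ is not seen. At the end, consider the IDs that occur exactly once in the center of the current snapshot; if there are any, let $v_{target}$ be the node of the center with the smallest of them. Increase $phase$ by $1$. Repeat this step until $v_{target}$ has been set. 3. *Merge*, $H$ rounds. Let $v_0$ be the first node of $P_\alpha$. Try to follow a shortest path of the snapshot from $v_0$ to $v_{target}$. If the next port does not exist, or a port of arrival differs from the one specified by the path, remove $v_0$ from $P_\alpha$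 and stay for the rest of the $H$ rounds. If the path has been followed without inconsistency, stay for the rest of the $H$ rounds, and in each round from the arrival to the end of the Merge inclusive remove $v_0$ from $P_\alpha$ if the snapshot has fewer than $n_{\max}$ nodes, or $l_\alpha$ is not seen at $v_{target}$, or $v_{target}$ and the local view have different degrees or different multisets of IDs. Then spend another $H$ rounds to reverse the moves of this Merge, and increase $phase$ by $1$. Repeat this step (executing it at least once) until $phase>\lceil m_{\max}/2\rceil$. 4. Execute Merge once more, without reversing it, and terminate. **Theorem 2.** Suppose that at least $f+1$ robots are non-faulty and that $H\ge R$. However the choices left open above (depth-first traversals, shortest paths, closest center nodes, first node of a set) are made, and whatever the Byzantine robots do, the H-View-Algorithm solves Gathering: there is a round $T$ in which all non-faulty robots terminate, and in this round they are all at the same node. Moreover $$T\le (m+2)\,n^2+H\cdot\max\{2\lceil m/2\rceil,\ \lceil m/2\rceil+3\};$$ in particular $T\le (m+2)n^2+H\,m$ if $m\ge 6$ is even, and $T\le 7\,m\,n^2=O(mn^2)$ whenever $H\le n$. -/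

import Mathlib

open scoped Classical

noncomputable section

namespace ByzGather

/-! ### Port-labelled graphs -/

/-- The degree of a node. -/
def deg {V : Type*} (G : SimpleGraph V) (v : V) : ℕ := (G.neighborSet v).ncard

/-- A port labelling of `G`: at every node `v` the incident edges carry the distinct labels
`0, …, deg v - 1`; `port v w` is the label, at `v`, of the edge joining `v` to its neighbour `w`
(the value is irrelevant if `w` is not a neighbour of `v`). The two ends of an edge are labelled
independently. -/
structure PortLabelling {V : Type*} (G : SimpleGraph V) where
  port : V → V → ℕ
  bijOn : ∀ v, Set.BijOn (port v) (G.neighborSet v) (Set.Iio (deg G v))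

/-- The node reached from `v` through the port `p` (and `v` itself if there is no port `p`). -/
def PortLabelling.cross {V : Type*} {G : SimpleGraph V} (L : PortLabelling G) (v : V) (p : ℕ) : V :=
  if h : ∃ w, G.Adj v w ∧ L.port v w = p then h.choose else v

/-- The port through which a robot enters its new node when it leaves `v` through the port `p`. -/
def PortLabelling.arrival {V : Type*} {G : SimpleGraph V} (L : PortLabelling G) (v : V) (p : ℕ) :
    Option ℕ :=
  if ∃ w, G.Adj v w ∧ L.port v w = p then some (L.port (L.cross v p) v) else none

/-! ### What a robot sees -/

/-- A snapshot: a finite port-labelled graph in which every node carries the list (a multiset) of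
the IDs of the robots that occupy it. The natural numbers naming the nodes are the private names
under which one robot keeps the nodes of its snapshots apart.
`link a p b q`: there is a visible edge between `a` and `b`, with port `p` at `a` and port `q`
at `b`. -/
structure Snapshot where
  nodes : Finset ℕ
  link : ℕ → ℕ → ℕ → ℕ → Prop
  ids : ℕ → Multiset ℕ

/-- The outcome of a Look operation. `deg` and `here` form the local view: the degree of the
current node (its ports are `0, …, deg - 1`) and the list of the IDs of all robots
at the current node, the robot itself included. `entry` is the port through which the robot has
just entered the node (`none` if it did not move in the previous round). `snap` is the partial
snapshot view; it does not tell the robot which of its nodes is the current one. -/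
structure Observation where
  deg : ℕ
  here : Multiset ℕ
  entry : Option ℕ
  snap : Snapshot

/-- The outcome of a Compute operation. -/
inductive Action where
  | stay : Action
  | move (p : ℕ) : Action
  | terminate : Action

/-- A deterministic distributed algorithm, executed by every non-faulty robot. A robot initially
knows its own ID only, and its memory is unbounded. -/
structure RobotAlgorithm where
  Memory : Type
  init : ℕ → Memory
  compute : Memory → Observation → Memory × Action

/-! ### Teams with strongly Byzantine robots, and executions -/

/-- A team of `m` robots in the graph `G`, together with everything that the adversary controls:
* the set `byz` of Byzantine robots;
* the IDs of the non-faulty robots, pairwise distinct, and their starting nodes;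
* the ID shown by, and the node occupied by, every Byzantine robot in every round: the ID is
  arbitrary in every round, and in each round the robot stays or moves to any neighbouring node;
* for every robot, the private names under which the (unlabelled) nodes appear in its snapshots.
  The names used by different robots are unrelated.
(The values of `ident` and `start` at Byzantine robots and those of `byzID` and `byzPos` at
non-faulty robots are not used.) -/
structure Team {V : Type*} (G : SimpleGraph V) (m : ℕ) where
  byz : Finset (Fin m)
  ident : Fin m → ℕ
  ident_inj : ∀ i ∉ byz, ∀ j ∉ byz, ident i = ident j → i = j
  start : Fin m → V
  byzID : ℕ → Fin m → ℕ
  byzPos : ℕ → Fin m → V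
  byzPos_step : ∀ t, ∀ i ∈ byz,
    byzPos (t + 1) i = byzPos t i ∨ G.Adj (byzPos t i) (byzPos (t + 1) i)
  naming : Fin m → V ↪ ℕ

/-- The ID shown by robot `i` in round `t`. -/
def Team.idAt {V : Type*} {G : SimpleGraph V} {m : ℕ} (A : Team G m) (t : ℕ) (i : Fin m) : ℕ :=
  if i ∈ A.byz then A.byzID t i else A.ident i

/-- The state of the system at the start of a round. (`entry`, `mem` and `halted` are
meaningless for Byzantine robots.) -/
structure Config (V : Type*) (m : ℕ) (Memory : Type) where
  pos : Fin m → V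
  entry : Fin m → Option ℕ
  mem : Fin m → Memory
  halted : Fin m → Bool

section Execution

variable {V : Type*} [Fintype V] {G : SimpleGraph V} {m : ℕ}

/-- The snapshot seen from the node `v` with visibility range `H`, when node `w` is
shown under the name `ν w`, robot `i` is at `pos i` and shows the ID `ident i`: the subgraph
induced by the nodes within distance `H` of `v`, with its port numbers and robot IDs. -/
def snapshot (L : PortLabelling G) (H : ℕ) (ν : V ↪ ℕ) (pos : Fin m → V) (ident : Fin m → ℕ)
    (v : V) : Snapshot where
  nodes := (Finset.univ.filter fun w : V => G.edist v w ≤ H).map ν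
  link a p b q := ∃ u w : V, G.edist v u ≤ H ∧ G.edist v w ≤ H ∧ G.Adj u w ∧
    ν u = a ∧ ν w = b ∧ L.port u w = p ∧ L.port w u = q
  ids a := (Finset.univ.filter fun i : Fin m => G.edist v (pos i) ≤ H ∧ ν (pos i) = a).val.map ident

/-- What robot `i` observes in round `t`, if `c` is the configuration at the start of round `t`. -/
def observe (L : PortLabelling G) (H : ℕ) (A : Team G m) {Memory : Type} (t : ℕ)
    (c : Config V m Memory) (i : Fin m) : Observation where
  deg := deg G (c.pos i)
  here := (Finset.univ.filter fun j : Fin m => c.pos j = c.pos i).val.map (A.idAt t)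
  entry := c.entry i
  snap := snapshot L H (A.naming i) c.pos (A.idAt t) (c.pos i)

/-- The execution of the algorithm `alg`: `run … t` is the configuration at the start of
round `t`. In each round every non-faulty robot that has not terminated performs its
Look-Compute-Move sequence. A robot that has terminated remains where it is. -/
def run (L : PortLabelling G) (H : ℕ) (A : Team G m) (alg : RobotAlgorithm) :
    ℕ → Config V m alg.Memory
  | 0 =>
    { pos := fun i => if i ∈ A.byz then A.byzPos 0 i else A.start i
      entry := fun _ => none
      mem := fun i => alg.init (A.ident i)
      halted := fun _ => false }
  | t + 1 =>
    let c := run L H A alg t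
    let d : Fin m → alg.Memory × Action := fun i => alg.compute (c.mem i) (observe L H A t c i)
    { pos := fun i =>
        if i ∈ A.byz then A.byzPos (t + 1) i
        else if c.halted i then c.pos i
        else match (d i).2 with
          | .move p => L.cross (c.pos i) p
          | _ => c.pos i
      entry := fun i =>
        if c.halted i then none
        else match (d i).2 with
          | .move p => L.arrival (c.pos i) p
          | _ => none
      mem := fun i => if c.halted i then c.mem i else (d i).1
      halted := fun i =>
        if c.halted i then true
        else match (d i).2 with
          | .terminate => true
          | _ => false }

/-- Gathering is solved in round `T`: every non-faulty robot terminates in round `T`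
(precisely: it executes `terminate` in round `T`), and in that round all of them are at the
same node. -/
def GatheredInRound (L : PortLabelling G) (H : ℕ) (A : Team G m) (alg : RobotAlgorithm)
    (T : ℕ) : Prop :=
  ∃ v : V, ∀ i ∉ A.byz, (run L H A alg T).halted i = false ∧
    (run L H A alg (T + 1)).halted i = true ∧ (run L H A alg T).pos i = v

end Execution

/-! ### Notions computed from a snapshot -/

namespace Snapshot

/-- The degree of a node of the snapshot (the number of its visible ports). -/
def deg (S : Snapshot) (a : ℕ) : ℕ := {p | ∃ b q, S.link a p b q}.ncard

/-- The number of robots in the snapshot. -/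
def robots (S : Snapshot) : ℕ := ∑ a ∈ S.nodes, (S.ids a).card

/-- The nodes of the snapshot that match the local view (same degree, same list of IDs). -/
def candidates (S : Snapshot) (degree : ℕ) (here : Multiset ℕ) : Finset ℕ :=
  S.nodes.filter fun a => S.deg a = degree ∧ S.ids a = here

/-- The underlying graph of the snapshot. -/
def graph (S : Snapshot) : SimpleGraph ℕ :=
  SimpleGraph.fromRel fun a b => ∃ p q, S.link a p b q

/-- Eccentricity within the snapshot. -/
def ecc (S : Snapshot) (a : ℕ) : ℕ := S.nodes.sup fun b => S.graph.dist a b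

/-- The nodes of minimum eccentricity. -/
def center (S : Snapshot) : Finset ℕ := S.nodes.filter fun a => ∀ b ∈ S.nodes, S.ecc a ≤ S.ecc b

/-- The list of the IDs of all robots in the center graph. -/
def centerIDs (S : Snapshot) : Multiset ℕ := ∑ a ∈ S.center, S.ids a

/-- The singleton IDs of the center graph: the IDs that appear there exactly once. -/
def singletonIDs (S : Snapshot) : Finset ℕ :=
  S.centerIDs.toFinset.filter fun l => S.centerIDs.count l = 1

/-- The node of the center graph that contains the robot with the smallest singleton ID of the
center graph (`none` if there is no singleton ID). -/
def target (S : Snapshot) : Option ℕ :=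
  if h : S.singletonIDs.Nonempty then
    ((S.center.filter fun a => S.singletonIDs.min' h ∈ S.ids a).sort (· ≤ ·)).head?
  else none

/-- `S.Follows a π b`: the path described by `π` leads from `a` to `b`; every step is given by its
outgoing port and its arrival port. -/
inductive Follows (S : Snapshot) : ℕ → List (ℕ × ℕ) → ℕ → Prop
  | nil (a : ℕ) : Follows S a [] a
  | cons {a p b q c : ℕ} {π : List (ℕ × ℕ)} (h : S.link a p b q) (hπ : Follows S b π c) :
      Follows S a ((p, q) :: π) c

/-- `π` describes a shortest path from `a` to `b`. -/
def IsShortestPath (S : Snapshot) (a b : ℕ) (π : List (ℕ × ℕ)) : Prop :=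
  S.Follows a π b ∧ ∀ π', S.Follows a π' b → π.length ≤ π'.length

/-- `b` is a node of the center graph closest to `a`. -/
def IsClosestCenter (S : Snapshot) (a b : ℕ) : Prop :=
  b ∈ S.center ∧ ∀ c ∈ S.center, S.graph.dist a b ≤ S.graph.dist a c

/-- `S.DFS X a τ Y`: a depth-first search standing at `a`, having visited the nodes of `X` so far,
follows the port sequence `τ` and is back at `a`, having visited the nodes of `Y`, with nothing
left to explore at `a`. As long as `a` has an unvisited neighbour, the search goes to some such
neighbour, explores from there recursively, and comes back through the same edge. -/
inductive DFS (S : Snapshot) : Finset ℕ → ℕ → List ℕ → Finset ℕ → Prop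
  | done {X : Finset ℕ} {a : ℕ} (h : ∀ p b q, S.link a p b q → b ∈ X) : DFS S X a [] X
  | visit {X Y Z : Finset ℕ} {a p b q : ℕ} {τ₁ τ₂ : List ℕ} (hl : S.link a p b q) (hb : b ∉ X)
      (h₁ : DFS S (insert b X) b τ₁ Y) (h₂ : DFS S Y a τ₂ Z) :
      DFS S X a (p :: (τ₁ ++ q :: τ₂)) Z

/-- `τ` is the port sequence of a depth-first traversal that starts at `a`. -/
def IsTraversal (S : Snapshot) (a : ℕ) (τ : List ℕ) : Prop := ∃ Y, S.DFS {a} a τ Y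

end Snapshot

/-! ### The H-View-Algorithm -/

/-- The choices left open in the description of the algorithm: which depth-first traversal,
which closest center node and which shortest path to take, and which element of a set of nodes
comes first. Each rule returns an object of the required kind whenever there is one. -/
structure Choices where
  traversal : Snapshot → ℕ → List ℕ
  traversal_spec : ∀ (S : Snapshot) (a : ℕ), (∃ τ, S.IsTraversal a τ) → S.IsTraversal a (traversal S a)
  closest : Snapshot → ℕ → ℕ
  closest_spec : ∀ (S : Snapshot) (a : ℕ), (∃ b, S.IsClosestCenter a b) → S.IsClosestCenter a (closest S a)
  path : Snapshot → ℕ → ℕ → List (ℕ × ℕ)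
  path_spec : ∀ (S : Snapshot) (a b : ℕ), (∃ π, S.IsShortestPath a b π) → S.IsShortestPath a b (path S a b)
  first : Finset ℕ → ℕ
  first_spec : ∀ P : Finset ℕ, P.Nonempty → first P ∈ P

instance : Nonempty Choices :=
  ⟨{ traversal := fun S a => Classical.epsilon (S.IsTraversal a)
     traversal_spec := fun _ _ h => Classical.epsilon_spec h
     closest := fun S a => Classical.epsilon (S.IsClosestCenter a)
     closest_spec := fun _ _ h => Classical.epsilon_spec h
     path := fun S a b => Classical.epsilon (S.IsShortestPath a b)
     path_spec := fun _ _ _ h => Classical.epsilon_spec h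
     first := fun P => Classical.epsilon (· ∈ P)
     first_spec := fun _ h => Classical.epsilon_spec h }⟩

/-- Program locations. `ahead` is the list of the ports (or pairs of outgoing and arrival
port) still to be taken; `back` the list of the ports still to be taken on the way back. -/
inductive Loc where
  /-- Find-Lookout: the very first instruction. -/
  | begin : Loc
  /-- Find-Lookout: an attempted traversal. `taken` are the ports taken since its beginning,
  `todo` the port sequences of the traversals that have not been attempted yet. -/
  | explore (todo : List (List ℕ)) (ahead taken : List ℕ) : Loc
  /-- Find-Lookout: return to the starting node. -/
  | retreat (todo : List (List ℕ)) (back : List ℕ) : Loc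
  /-- Find-Lookout: final walk to `v_max`. -/
  | approach (ahead : List ℕ) : Loc
  /-- Wait at `v_max` until round `(m_max + 2) n_max²`. -/
  | lookout : Loc
  /-- March-to-Center: first instruction. -/
  | march : Loc
  /-- March-to-Center, one candidate location: go to the center node `dest` and wait. -/
  | marchMove (dest : ℕ) (ahead : List ℕ) : Loc
  /-- March-to-Center, several candidate locations: wait and watch. -/
  | marchWatch : Loc
  /-- March-to-Center: last instruction, and end of the body of the first loop. -/
  | marchEnd : Loc
  /-- Merge: first instruction. `final` marks the last execution, after the second loop. -/
  | merge (final : Bool) : Loc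
  /-- Merge: walk along the path that starts at `v₀`. `expect` is the arrival port specified by
  the path for the step just made (`none` before the first step). -/
  | mergeMove (final : Bool) (v₀ : ℕ) (expect : Option ℕ) (ahead : List (ℕ × ℕ)) : Loc
  /-- Merge: the path was followed with no inconsistency; wait and check. -/
  | mergeCheck (final : Bool) (v₀ : ℕ) : Loc
  /-- Merge: an inconsistency occurred; wait. -/
  | mergeStuck (final : Bool) : Loc
  /-- Merge: end. -/
  | mergeEnd (final : Bool) : Loc
  /-- The previous Merge in reverse, and end of the body of the second loop. -/
  | reverse (back : List ℕ) : Loc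

/-- The memory of a robot. -/
structure Mem where
  /-- the robot's own ID -/
  me : ℕ
  /-- number of the current round -/
  clock : ℕ
  /-- the program location -/
  loc : Loc
  /-- arrival ports of the moves since the last reset, most recent first -/
  trail : List ℕ
  /-- largest number of nodes seen so far, and number of robots and port sequence from the
  starting node where this was first witnessed -/
  nmax : ℕ
  mmax : ℕ
  τmax : List ℕ
  /-- the candidates for the current location (at the beginning of each March-to-Center and
  of each Merge) -/
  P : Finset ℕ
  target : Option ℕ
  phase : ℕ
  /-- round in which the current March-to-Center, Merge or reversal ends -/
  deadline : ℕ

/-- One instruction of the H-View-Algorithm, in a round with observation `o`. The result is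
`.inr s` if the computation of the current round continues with memory `s`, and `.inl (s, a)` if
it ends with action `a`. -/
def instr (ch : Choices) (H : ℕ) (o : Observation) (s : Mem) : (Mem × Action) ⊕ Mem :=
  match s.loc with
  | .begin =>
    -- one attempted traversal for each node that looks like the starting node
    let X := o.snap.candidates o.deg o.here
    .inr { s with loc := .retreat ((X.sort (· ≤ ·)).map (ch.traversal o.snap)) [] }
  | .explore todo ahead taken =>
    let s := if s.nmax < o.snap.nodes.card then
      { s with nmax := o.snap.nodes.card, mmax := o.snap.robots, τmax := taken } else s
    match ahead with
    | p :: rest =>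
      if p < o.deg then .inl ({ s with loc := .explore todo rest (taken ++ [p]) }, .move p)
      else .inr { s with loc := .retreat todo s.trail }
    | [] => .inr { s with loc := .retreat todo s.trail }
  | .retreat todo (p :: rest) => .inl ({ s with loc := .retreat todo rest }, .move p)
  | .retreat (τ :: todo) [] => .inr { s with loc := .explore todo τ [], trail := [] }
  | .retreat [] [] => .inr { s with loc := .approach s.τmax }
  | .approach (p :: rest) => .inl ({ s with loc := .approach rest }, .move p)
  | .approach [] => .inr { s with loc := .lookout }
  | .lookout =>
    if s.clock < (s.mmax + 2) * s.nmax ^ 2 then .inl (s, .stay)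
    else .inr { s with
      loc := .march, P := o.snap.candidates o.deg o.here, target := none, phase := 1 }
  | .march =>
    let s := { s with deadline := s.clock + H }
    if s.P.card = 1 then
      let v₀ := ch.first s.P
      let dest := ch.closest o.snap v₀
      .inr { s with loc := .marchMove dest ((ch.path o.snap v₀ dest).map Prod.fst) }
    else .inr { s with loc := .marchWatch }
  | .marchMove dest (p :: rest) => .inl ({ s with loc := .marchMove dest rest }, .move p)
  | .marchMove dest [] =>
    if s.clock < s.deadline then .inl (s, .stay)
    else .inr { s with loc := .marchEnd, P := {dest} }
  | .marchWatch =>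
    let s := { s with P := s.P.filter fun a => s.me ∈ o.snap.ids a }
    if s.clock < s.deadline then .inl (s, .stay) else .inr { s with loc := .marchEnd }
  | .marchEnd =>
    -- set the target, increment `phase`, and leave the first loop if the target is not null
    .inr { s with
      target := o.snap.target
      phase := s.phase + 1
      loc := if o.snap.target = none then .march else .merge false }
  | .merge final =>
    -- the target is not null here
    let v₀ := ch.first s.P
    .inr { s with
      deadline := s.clock + H
      trail := []
      loc := .mergeMove final v₀ none (ch.path o.snap v₀ (s.target.getD 0)) }
  | .mergeMove final v₀ expect ahead =>
    if expect ≠ none ∧ o.entry ≠ expect then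
      .inr { s with loc := .mergeStuck final, P := s.P.erase v₀ }
    else match ahead with
      | (p, q) :: rest =>
        if p < o.deg then .inl ({ s with loc := .mergeMove final v₀ (some q) rest }, .move p)
        else .inr { s with loc := .mergeStuck final, P := s.P.erase v₀ }
      | [] => .inr { s with loc := .mergeCheck final v₀ }
  | .mergeCheck final v₀ =>
    let c := s.target.getD 0
    let s := if o.snap.nodes.card < s.nmax ∨ s.me ∉ o.snap.ids c ∨
        o.snap.deg c ≠ o.deg ∨ o.snap.ids c ≠ o.here then { s with P := s.P.erase v₀ } else s
    if s.clock < s.deadline then .inl (s, .stay) else .inr { s with loc := .mergeEnd final }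
  | .mergeStuck final =>
    if s.clock < s.deadline then .inl (s, .stay) else .inr { s with loc := .mergeEnd final }
  | .mergeEnd true => .inl (s, .terminate)
  | .mergeEnd false => .inr { s with loc := .reverse s.trail, deadline := s.clock + H }
  | .reverse (p :: rest) => .inl ({ s with loc := .reverse rest }, .move p)
  | .reverse [] =>
    if s.clock < s.deadline then .inl (s, .stay)
    else
      -- leave the second loop as soon as `phase > ⌈m_max / 2⌉`
      .inr { s with
        phase := s.phase + 1
        loc := if s.phase + 1 > (s.mmax + 1) / 2 then .merge true else .merge false }

/-- The computation of one round: record the port of arrival, if any, then execute instructions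
until one of them ends the round. (A robot that would compute forever stays where it is.) -/
def hViewCompute (ch : Choices) (H : ℕ) (s : Mem) (o : Observation) : Mem × Action :=
  let s₀ := { s with trail := o.entry.toList ++ s.trail }
  let r := PFun.fix (fun s' => Part.some (instr ch H o s')) s₀
  if h : r.Dom then ({ (r.get h).1 with clock := s.clock + 1 }, (r.get h).2) else (s, .stay)

/-- The H-View-Algorithm for robots with visibility range `H`. -/
def hView (ch : Choices) (H : ℕ) : RobotAlgorithm where
  Memory := Mem
  init me :=
    { me := me, clock := 0, loc := .begin, trail := [], nmax := 0, mmax := 0, τmax := [],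
      P := ∅, target := none, phase := 1, deadline := 0 }
  compute := hViewCompute ch H

end ByzGather

end

/-! Everything rests on counting impostors. Consider the pairs (i, w) such that in a given round
some Byzantine robot at the node w shows the ID of the non-faulty robot i. A Byzantine robot is at
one node and shows one ID, and non-faulty IDs are distinct, so there are at most f such pairs
(`sum_card_impostors_le`), fewer than there are non-faulty robots. If the ID of i is seen at a node
where i is not, this gives such a pair.

Hence a robot has at most f + 1 candidates for its initial location. The traversal computed from the
true one can be carried out in the network, and it passes a node within distance H of all others,
because the snapshot contains a whole path to such a node. So every robot learns n and m and waits
with a full view. As 2(f + 1) ≤ m + 1, all attempts fit into (m + 2)n² rounds (`lookout_reached`).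

From then on the potential is `excess`, the total number of wrong candidates of the non-faulty
robots, at most f at the start; the true location is never removed. If a March-to-Center yields no
target, let M be the set of robots that had a single candidate. They are in the center, where each
of their IDs is duplicated; the wrong candidates left to the others show their IDs. So the new
excess plus |M| is at most f, whereas the old excess plus |M| is at least the number of non-faulty
robots, hence more than f. The excess has dropped (`march_loop`). Once there is a target it is the
same node c for all, since full snapshots differ only in node names (`target_dichotomy`).

In a Merge, a robot that tries its true location reaches c, and one that tries a wrong location
cannot end at c, because a path with both port numbers can be reversed. Suppose somebody tries a
wrong location but nobody discards a candidate. Then each wrong robot sees its ID at c, and one of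
them, at y ≠ c, certifies that y shows the same IDs as c, including those of the robots that really
are at c. Every non-faulty robot thus has an impostor, a contradiction. So a Merge either brings all
robots to c or lowers the excess (`Stage.merge`). After K marches the excess is at most f + 1 - K ≤
⌈m/2⌉ - K, so max(1, ⌈m/2⌉ - K) reversed Merges suffice before the final one. -/

namespace ByzGather

/-! ### Trips in a port-labelled graph -/

section Trips

variable {V : Type*} {G : SimpleGraph V} (L : PortLabelling G)

/-- `L.Trip v π w`: the path described by `π` (outgoing port and arrival port of every step) leads
from `v` to `w` in the network. -/
def PortLabelling.Trip : V → List (ℕ × ℕ) → V → Prop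
  | v, [], w => v = w
  | v, (p, q) :: π, w =>
    ∃ u, G.Adj v u ∧ L.port v u = p ∧ L.port u v = q ∧ PortLabelling.Trip u π w

variable {L}

namespace PortLabelling

theorem port_injective {v u u' : V} (h : G.Adj v u) (h' : G.Adj v u')
    (e : L.port v u = L.port v u') : u = u' :=
  (L.bijOn v).injOn h h' e

theorem lt_deg_iff {v : V} {p : ℕ} : p < deg G v ↔ ∃ u, G.Adj v u ∧ L.port v u = p := by
  constructor
  · intro h
    obtain ⟨u, hu, e⟩ := (L.bijOn v).surjOn (Set.mem_Iio.2 h)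
    exact ⟨u, hu, e⟩
  · rintro ⟨u, hu, rfl⟩
    exact (L.bijOn v).mapsTo hu

theorem cross_port {v u : V} (h : G.Adj v u) : L.cross v (L.port v u) = u := by
  have hex : ∃ w, G.Adj v w ∧ L.port v w = L.port v u := ⟨u, h, rfl⟩
  rw [cross, dif_pos hex]
  exact port_injective hex.choose_spec.1 h hex.choose_spec.2

theorem arrival_port {v u : V} (h : G.Adj v u) :
    L.arrival v (L.port v u) = some (L.port u v) := by
  rw [arrival, if_pos ⟨u, h, rfl⟩, cross_port h]

theorem Trip.append {v u w : V} {π ρ : List (ℕ × ℕ)} (h : L.Trip v π u) (h' : L.Trip u ρ w) :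
    L.Trip v (π ++ ρ) w := by
  induction π generalizing v with
  | nil => cases h; exact h'
  | cons a π ih =>
    obtain ⟨x, hx, e, e', hπ⟩ := h
    exact ⟨x, hx, e, e', ih hπ⟩

theorem Trip.snoc {v u w : V} {π : List (ℕ × ℕ)} (h : L.Trip v π u) (hw : G.Adj u w) :
    L.Trip v (π ++ [(L.port u w, L.port w u)]) w :=
  h.append ⟨w, hw, rfl, rfl, rfl⟩

theorem Trip.reverse {v w : V} {π : List (ℕ × ℕ)} (h : L.Trip v π w) :
    L.Trip w (π.map Prod.swap).reverse v := by
  induction π generalizing v with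
  | nil => cases h; rfl
  | cons a π ih =>
    obtain ⟨x, hx, e, e', hπ⟩ := h
    rw [List.map_cons, List.reverse_cons]
    exact (ih hπ).append ⟨v, hx.symm, e', e, rfl⟩

theorem Trip.unique {v w w' : V} {π : List (ℕ × ℕ)} (h : L.Trip v π w) (h' : L.Trip v π w') :
    w = w' := by
  induction π generalizing v with
  | nil => cases h; cases h'; rfl
  | cons a π ih =>
    obtain ⟨x, hx, e, -, hπ⟩ := h
    obtain ⟨y, hy, f, -, hπ'⟩ := h'
    cases port_injective hx hy (e.trans f.symm)
    exact ih hπ hπ'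

/-- This is what checking arrival ports buys: a path determines its start from its end, so a path
computed from a wrong candidate never leads from the true location to the target. -/
theorem Trip.unique_left {v v' w : V} {π : List (ℕ × ℕ)} (h : L.Trip v π w) (h' : L.Trip v' π w) :
    v = v' :=
  h.reverse.unique h'.reverse

theorem exists_trip_of_walk {v w : V} (p : G.Walk v w) :
    ∃ π, L.Trip v π w ∧ π.length = p.length := by
  induction p with
  | nil => exact ⟨[], rfl, rfl⟩
  | cons h p ih =>
    obtain ⟨π, hπ, e⟩ := ih
    exact ⟨(_, _) :: π, ⟨_, h, rfl, rfl, hπ⟩, by simp [e]⟩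

end PortLabelling

end Trips

/-! ### Snapshots with full view -/

section FullView

variable {V : Type*} {G : SimpleGraph V}

/-- All nodes are within distance `H` of `v`. -/
def Full (G : SimpleGraph V) (H : ℕ) (v : V) : Prop := ∀ w, G.edist v w ≤ H

theorem full_iff_dist (hG : G.Connected) {H : ℕ} {v : V} : Full G H v ↔ ∀ w, G.dist v w ≤ H := by
  refine forall_congr' fun w => ?_
  rw [← (hG v w).coe_dist_eq_edist]
  exact Nat.cast_le

theorem exists_full (hG : G.Connected) {H : ℕ} (hH : G.radius ≤ (H : ℕ∞)) : ∃ v, Full G H v := by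
  have := hG.nonempty
  obtain ⟨v, hv⟩ := G.exists_eccent_eq_radius
  exact ⟨v, fun w => (G.edist_le_eccent).trans (hv.le.trans hH)⟩

/-- The IDs shown at the node `v`. -/
noncomputable def idsAt {m : ℕ} (pos : Fin m → V) (ident : Fin m → ℕ) (v : V) : Multiset ℕ :=
  (Finset.univ.filter fun i => pos i = v).val.map ident

variable {L : PortLabelling G} {H m : ℕ} {ν : V ↪ ℕ} {pos : Fin m → V} {ident : Fin m → ℕ} {v : V}

theorem mem_idsAt {w : V} {l : ℕ} : l ∈ idsAt pos ident w ↔ ∃ j, pos j = w ∧ ident j = l := by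
  simp [idsAt]

theorem count_sum_idsAt (C : Finset V) (l : ℕ) :
    (∑ w ∈ C, idsAt pos ident w).count l =
      (Finset.univ.filter fun j => pos j ∈ C ∧ ident j = l).card := by
  rw [Multiset.count_sum', Finset.card_eq_sum_card_fiberwise (f := pos) (t := C)
    (fun j hj => (Finset.mem_filter.1 hj).2.1)]
  refine Finset.sum_congr rfl fun w hw => ?_
  rw [idsAt, Multiset.count_map, ← Finset.filter_val, Finset.card_val, Finset.filter_filter,
    Finset.filter_filter]
  congr 1
  ext j
  simp only [Finset.mem_filter, Finset.mem_univ, true_and]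
  constructor
  · rintro ⟨rfl, rfl⟩
    exact ⟨⟨hw, rfl⟩, rfl⟩
  · rintro ⟨⟨-, rfl⟩, rfl⟩
    exact ⟨rfl, rfl⟩

variable [Fintype V]

/-- The eccentricity of a node, computed from distances in `ℕ`. -/
noncomputable def eccentricity (G : SimpleGraph V) (v : V) : ℕ := Finset.univ.sup (G.dist v)

/-- The nodes of minimum eccentricity. -/
noncomputable def centerNodes (G : SimpleGraph V) : Finset V :=
  Finset.univ.filter fun v => ∀ w, eccentricity G v ≤ eccentricity G w

theorem centerNodes_nonempty [Nonempty V] : (centerNodes G).Nonempty := by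
  obtain ⟨v, -, hv⟩ := Finset.exists_min_image Finset.univ (eccentricity G) Finset.univ_nonempty
  exact ⟨v, by simpa [centerNodes] using hv⟩

/-- A node of minimum eccentricity is no worse than one that realises the radius. Robots that march
to the center therefore keep their full view. -/
theorem full_of_mem_centerNodes (hG : G.Connected) {H : ℕ} (hH : G.radius ≤ (H : ℕ∞)) {v : V}
    (hv : v ∈ centerNodes G) : Full G H v := by
  obtain ⟨u, hu⟩ := exists_full hG hH
  rw [full_iff_dist hG] at hu ⊢
  intro w
  have h1 : G.dist v w ≤ eccentricity G v := Finset.le_sup (f := G.dist v) (Finset.mem_univ w)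
  have h2 : eccentricity G v ≤ eccentricity G u := (Finset.mem_filter.1 hv).2 u
  exact h1.trans (h2.trans (Finset.sup_le fun w _ => hu w))

theorem card_nodes_le : (snapshot L H ν pos ident v).nodes.card ≤ Fintype.card V := by
  rw [snapshot, Finset.card_map]
  exact Finset.card_le_univ _

theorem full_of_card_nodes (h : Fintype.card V ≤ (snapshot L H ν pos ident v).nodes.card) :
    Full G H v := by
  rw [snapshot, Finset.card_map] at h
  have := Finset.eq_univ_of_card _ (le_antisymm (Finset.card_le_univ _) h)
  intro w
  have hw := Finset.mem_univ w
  rw [← this] at hw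
  exact (Finset.mem_filter.1 hw).2

theorem snapshot_nodes (hv : Full G H v) :
    (snapshot L H ν pos ident v).nodes = Finset.univ.map ν := by
  simp [snapshot, Finset.filter_true_of_mem fun w _ => hv w]

theorem snapshot_card (hv : Full G H v) :
    (snapshot L H ν pos ident v).nodes.card = Fintype.card V := by
  rw [snapshot_nodes hv, Finset.card_map, Finset.card_univ]

theorem snapshot_link (hv : Full G H v) {u : V} {p b q : ℕ} :
    (snapshot L H ν pos ident v).link (ν u) p b q ↔
      ∃ w, G.Adj u w ∧ ν w = b ∧ L.port u w = p ∧ L.port w u = q := by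
  constructor
  · rintro ⟨u', w, -, -, h, e, h'⟩
    cases ν.injective e
    exact ⟨w, h, h'⟩
  · rintro ⟨w, h, h'⟩
    exact ⟨u, w, hv u, hv w, h, rfl, h'⟩

theorem snapshot_ids_of_le {w : V} (hw : G.edist v w ≤ H) :
    (snapshot L H ν pos ident v).ids (ν w) = idsAt pos ident w := by
  simp only [snapshot, idsAt]
  congr 2
  ext i
  simp only [Finset.mem_filter, Finset.mem_univ, true_and, ν.injective.eq_iff]
  exact ⟨fun h => h.2, fun h => ⟨h ▸ hw, h⟩⟩

theorem snapshot_ids (hv : Full G H v) {w : V} :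
    (snapshot L H ν pos ident v).ids (ν w) = idsAt pos ident w :=
  snapshot_ids_of_le (hv w)

theorem snapshot_robots (hv : Full G H v) : (snapshot L H ν pos ident v).robots = m := by
  rw [Snapshot.robots, snapshot_nodes hv, Finset.sum_map]
  simp_rw [snapshot_ids hv, idsAt, Multiset.card_map, Finset.card_val]
  have h := Finset.card_eq_sum_card_fiberwise (f := pos) (s := Finset.univ) (t := Finset.univ)
    fun i _ => Finset.mem_coe.2 (Finset.mem_univ _)
  rw [← h, Finset.card_univ, Fintype.card_fin]

theorem snapshot_deg_of_le {w : V} (hw : G.edist v w ≤ H) (hn : ∀ u, G.Adj w u → G.edist v u ≤ H) :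
    (snapshot L H ν pos ident v).deg (ν w) = deg G w := by
  have : {p | ∃ b q, (snapshot L H ν pos ident v).link (ν w) p b q} = Set.Iio (deg G w) := by
    ext p
    rw [Set.mem_Iio, PortLabelling.lt_deg_iff (L := L)]
    constructor
    · rintro ⟨b, q, u', x, -, -, h, e, -, e', -⟩
      cases ν.injective e
      exact ⟨x, h, e'⟩
    · rintro ⟨u, h, e⟩
      exact ⟨ν u, _, w, u, hw, hn u h, h, rfl, rfl, e, rfl⟩
  rw [Snapshot.deg, this, Set.ncard_eq_toFinset_card']
  simp

theorem snapshot_deg (hv : Full G H v) {w : V} :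
    (snapshot L H ν pos ident v).deg (ν w) = deg G w :=
  snapshot_deg_of_le (hv w) fun u _ => hv u

theorem snapshot_follows (hv : Full G H v) {u : V} {π : List (ℕ × ℕ)} {b : ℕ} :
    (snapshot L H ν pos ident v).Follows (ν u) π b ↔ ∃ w, b = ν w ∧ L.Trip u π w := by
  constructor
  · intro h
    generalize ha : ν u = a at h
    induction h generalizing u with
    | nil a => exact ⟨u, ha.symm, rfl⟩
    | cons h _ ih =>
      subst ha
      obtain ⟨x, hx, rfl, hp, hq⟩ := (snapshot_link hv).1 h
      obtain ⟨w, rfl, hw⟩ := ih rfl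
      exact ⟨w, rfl, x, hx, hp, hq, hw⟩
  · rintro ⟨w, rfl, h⟩
    induction π generalizing u with
    | nil => cases h; exact .nil _
    | cons a π ih =>
      obtain ⟨x, hx, hp, hq, hw⟩ := h
      exact .cons ((snapshot_link hv).2 ⟨x, hx, rfl, hp, hq⟩) (ih hw)

theorem snapshot_graph_adj (hv : Full G H v) {u : V} {b : ℕ} :
    (snapshot L H ν pos ident v).graph.Adj (ν u) b ↔ ∃ w, b = ν w ∧ G.Adj u w := by
  rw [Snapshot.graph, SimpleGraph.fromRel_adj]
  constructor
  · rintro ⟨-, ⟨p, q, h⟩ | ⟨p, q, h⟩⟩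
    · obtain ⟨w, hw, rfl, -⟩ := (snapshot_link hv).1 h
      exact ⟨w, rfl, hw⟩
    · obtain ⟨u', w, -, -, hw, rfl, e, -⟩ := h
      cases ν.injective e
      exact ⟨u', rfl, hw.symm⟩
  · rintro ⟨w, rfl, h⟩
    exact ⟨fun e => h.ne (ν.injective e), .inl ⟨_, _, (snapshot_link hv).2 ⟨w, h, rfl, rfl, rfl⟩⟩⟩

/-- The snapshot graph lives on all of ℕ, but a walk that begins at the name of a node never leaves
the names, so it lifts to `G`. Reachability has to be checked, because `dist` is 0 between
unreachable nodes. -/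
theorem snapshot_dist (hG : G.Connected) (hv : Full G H v) (u w : V) :
    (snapshot L H ν pos ident v).graph.dist (ν u) (ν w) = G.dist u w := by
  set S := snapshot L H ν pos ident v
  let φ : G →g S.graph := ⟨ν, fun {a b} h => (snapshot_graph_adj hv).2 ⟨b, rfl, h⟩⟩
  obtain ⟨p, hp⟩ := hG.exists_walk_length_eq_dist u w
  have lift : ∀ {a b : ℕ} (q : S.graph.Walk a b) (u : V), a = ν u →
      ∃ w, b = ν w ∧ ∃ q' : G.Walk u w, q'.length = q.length := by
    intro a b q
    induction q with
    | nil => exact fun u h => ⟨u, h, .nil, rfl⟩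
    | cons h q ih =>
      rintro u rfl
      obtain ⟨x, hx, hux⟩ := (snapshot_graph_adj hv).1 h
      obtain ⟨w, hw, q', e⟩ := ih x hx
      exact ⟨w, hw, .cons hux q', by simp [e]⟩
  apply le_antisymm
  · rw [← hp]
    exact (SimpleGraph.dist_le (p.map φ)).trans_eq (p.length_map φ)
  · have hr : S.graph.Reachable (ν u) (ν w) := ⟨p.map φ⟩
    obtain ⟨q, hq⟩ := hr.exists_walk_length_eq_dist
    obtain ⟨w', e, q', hq'⟩ := lift q u rfl
    cases ν.injective e
    rw [← hq, ← hq']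
    exact SimpleGraph.dist_le q'

theorem snapshot_center (hG : G.Connected) (hv : Full G H v) :
    (snapshot L H ν pos ident v).center = (centerNodes G).map ν := by
  have hecc : ∀ w, (snapshot L H ν pos ident v).ecc (ν w) = eccentricity G w := by
    intro w
    rw [Snapshot.ecc, snapshot_nodes hv, Finset.sup_map, eccentricity]
    congr 1
    funext x
    exact snapshot_dist hG hv w x
  ext a
  simp only [Snapshot.center, snapshot_nodes hv, Finset.mem_filter, Finset.mem_map,
    Finset.mem_univ, true_and, centerNodes]
  constructor
  · rintro ⟨⟨w, rfl⟩, h⟩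
    exact ⟨w, fun x => by simpa [hecc] using h (ν x) ⟨x, rfl⟩, rfl⟩
  · rintro ⟨w, h, rfl⟩
    refine ⟨⟨w, rfl⟩, ?_⟩
    rintro _ ⟨x, rfl⟩
    simpa [hecc] using h x

theorem snapshot_centerIDs (hG : G.Connected) (hv : Full G H v) :
    (snapshot L H ν pos ident v).centerIDs = ∑ w ∈ centerNodes G, idsAt pos ident w := by
  rw [Snapshot.centerIDs, snapshot_center hG hv, Finset.sum_map]
  exact Finset.sum_congr rfl fun w _ => snapshot_ids hv

theorem snapshot_candidates (hv : Full G H v) (w : V) :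
    (snapshot L H ν pos ident v).candidates (deg G w) (idsAt pos ident w) =
      (Finset.univ.filter fun u => deg G u = deg G w ∧
        idsAt pos ident u = idsAt pos ident w).map ν := by
  ext a
  simp only [Snapshot.candidates, snapshot_nodes hv, Finset.mem_filter, Finset.mem_map,
    Finset.mem_univ, true_and]
  constructor
  · rintro ⟨⟨u, rfl⟩, h⟩
    rw [snapshot_deg hv, snapshot_ids hv] at h
    exact ⟨u, h, rfl⟩
  · rintro ⟨u, h, rfl⟩
    rw [snapshot_deg hv, snapshot_ids hv]
    exact ⟨⟨u, rfl⟩, h⟩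

/-- Either no ID occurs exactly once in the center, and then no robot with full view has a target;
or there is a node of the center which all robots with full view select. -/
theorem target_dichotomy (hG : G.Connected) (L : PortLabelling G) (H : ℕ) (pos : Fin m → V)
    (ident : Fin m → ℕ) :
    ((∀ (ν : V ↪ ℕ) (v : V), Full G H v → (snapshot L H ν pos ident v).target = none) ∧
      ∀ i, pos i ∈ centerNodes G → ∃ j, j ≠ i ∧ ident j = ident i) ∨
    ∃ c ∈ centerNodes G, ∀ (ν : V ↪ ℕ) (v : V), Full G H v →
      (snapshot L H ν pos ident v).target = some (ν c) := by
  set M := ∑ w ∈ centerNodes G, idsAt pos ident w with hM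
  set F := M.toFinset.filter fun l => M.count l = 1 with hF
  have hS : ∀ (ν : V ↪ ℕ) (v : V), Full G H v → (snapshot L H ν pos ident v).singletonIDs = F :=
    fun ν v hv => by rw [Snapshot.singletonIDs, snapshot_centerIDs hG hv]
  by_cases hne : F.Nonempty
  · right
    have hmin := F.min'_mem hne
    set l := F.min' hne with hl
    have hcount := (Finset.mem_filter.1 hmin).2
    rw [hM, count_sum_idsAt, Finset.card_eq_one] at hcount
    obtain ⟨j, hj⟩ := hcount
    have hj' : ∀ k, (pos k ∈ centerNodes G ∧ ident k = l) ↔ k = j := fun k => by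
      simpa using Finset.ext_iff.1 hj k
    refine ⟨pos j, ((hj' j).2 rfl).1, fun ν v hv => ?_⟩
    have hne' : (snapshot L H ν pos ident v).singletonIDs.Nonempty := by rwa [hS ν v hv]
    rw [Snapshot.target, dif_pos hne']
    -- Sorting by private names could break the agreement between robots. It does not, since only
    -- one node of the center shows the ID `l`.
    have : ((snapshot L H ν pos ident v).center.filter fun a =>
        (snapshot L H ν pos ident v).singletonIDs.min' hne' ∈
          (snapshot L H ν pos ident v).ids a) = {ν (pos j)} := by
      ext a
      simp only [hS ν v hv, snapshot_center hG hv, Finset.mem_filter, Finset.mem_map,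
        Finset.mem_singleton]
      constructor
      · rintro ⟨⟨w, hw, rfl⟩, h⟩
        rw [snapshot_ids hv, mem_idsAt] at h
        obtain ⟨k, rfl, hk⟩ := h
        rw [(hj' k).1 ⟨hw, hk⟩]
      · rintro rfl
        refine ⟨⟨pos j, ((hj' j).2 rfl).1, rfl⟩, ?_⟩
        rw [snapshot_ids hv, mem_idsAt]
        exact ⟨j, rfl, ((hj' j).2 rfl).2⟩
    rw [this, Finset.sort_singleton]
    rfl
  · left
    refine ⟨fun ν v hv => ?_, fun i hi => ?_⟩
    · rw [Snapshot.target, dif_neg]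
      rwa [hS ν v hv]
    · by_contra! hcon
      apply hne
      refine ⟨ident i, ?_⟩
      have hc : M.count (ident i) = 1 := by
        rw [hM, count_sum_idsAt, Finset.card_eq_one]
        refine ⟨i, ?_⟩
        ext k
        simp only [Finset.mem_filter, Finset.mem_univ, true_and, Finset.mem_singleton]
        refine ⟨fun h => ?_, ?_⟩
        · by_contra hk
          exact hcon k hk h.2
        · rintro rfl
          exact ⟨hi, rfl⟩
      rw [hF, Finset.mem_filter, Multiset.mem_toFinset, ← Multiset.count_pos, hc]
      exact ⟨one_pos, rfl⟩

/-! ### Shortest paths and closest center nodes in full snapshots -/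

theorem exists_shortestPath {S : Snapshot} {a b : ℕ} (h : ∃ π, S.Follows a π b) :
    ∃ π, S.IsShortestPath a b π := by
  have hex : ∃ k, ∃ π, S.Follows a π b ∧ π.length = k := h.elim fun π hπ => ⟨_, π, hπ, rfl⟩
  obtain ⟨π, hπ, hl⟩ := Nat.find_spec hex
  exact ⟨π, hπ, fun π' hπ' => hl.le.trans (Nat.find_min' hex ⟨π', hπ', rfl⟩)⟩

/-- In a snapshot with full view, the chosen path to a node with full view is a trip in the
network, with at most `H` steps. -/
theorem path_trip (hG : G.Connected) (ch : Choices) (hv : Full G H v) {c : V} (hc : Full G H c)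
    (u : V) :
    L.Trip u (ch.path (snapshot L H ν pos ident v) (ν u) (ν c)) c ∧
      (ch.path (snapshot L H ν pos ident v) (ν u) (ν c)).length ≤ H := by
  obtain ⟨p, hp⟩ := hG.exists_walk_length_eq_dist u c
  obtain ⟨π, hπ, hl⟩ := PortLabelling.exists_trip_of_walk (L := L) p
  have hf : (snapshot L H ν pos ident v).Follows (ν u) π (ν c) :=
    (snapshot_follows hv).2 ⟨c, rfl, hπ⟩
  obtain ⟨h1, h2⟩ := ch.path_spec _ _ _ (exists_shortestPath ⟨π, hf⟩)
  obtain ⟨w, e, hw⟩ := (snapshot_follows hv).1 h1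
  cases ν.injective e
  refine ⟨hw, (h2 π hf).trans ?_⟩
  rw [hl, hp, SimpleGraph.dist_comm]
  exact (full_iff_dist hG).1 hc u

theorem closest_mem (hG : G.Connected) (ch : Choices) (hv : Full G H v) (a : ℕ) :
    ∃ c ∈ centerNodes G, ch.closest (snapshot L H ν pos ident v) a = ν c := by
  have := hG.nonempty
  have hne : (snapshot L H ν pos ident v).center.Nonempty := by
    rw [snapshot_center hG hv]
    exact centerNodes_nonempty.map
  obtain ⟨b, hb, hmin⟩ := Finset.exists_min_image _
    ((snapshot L H ν pos ident v).graph.dist a) hne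
  have h := (ch.closest_spec _ a ⟨b, hb, hmin⟩).1
  rw [snapshot_center hG hv, Finset.mem_map] at h
  obtain ⟨c, hc, e⟩ := h
  exact ⟨c, hc, e.symm⟩

end FullView

/-! ### Depth-first traversals -/

namespace Snapshot

variable {S : Snapshot} {X Y : Finset ℕ} {a : ℕ} {τ : List ℕ}

theorem DFS.subset (h : S.DFS X a τ Y) : X ⊆ Y := by
  induction h with
  | done => exact Finset.Subset.refl _
  | visit _ _ _ _ ih₁ ih₂ => exact (Finset.subset_insert _ _).trans (ih₁.trans ih₂)

theorem DFS.subset_nodes (hS : ∀ a p b q, S.link a p b q → b ∈ S.nodes) (h : S.DFS X a τ Y)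
    (hX : X ⊆ S.nodes) : Y ⊆ S.nodes := by
  induction h with
  | done => exact hX
  | visit hl _ _ _ ih₁ ih₂ => exact ih₂ (ih₁ (Finset.insert_subset (hS _ _ _ _ hl) hX))

/-- Each newly visited node costs one step in and one step back. -/
theorem DFS.length (h : S.DFS X a τ Y) : τ.length + 2 * X.card = 2 * Y.card := by
  induction h with
  | done => simp
  | visit _ hb _ _ ih₁ ih₂ =>
    rw [Finset.card_insert_of_notMem hb] at ih₁
    simp only [List.length_cons, List.length_append]
    omega

/-- Nodes of `X` may still be under exploration higher up in the recursion, so nothing is claimed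
for them except for `a`. For `X = {a}` the two clauses together say that `Y` is closed under links.
-/
theorem DFS.closed (h : S.DFS X a τ Y) :
    (∀ p b q, S.link a p b q → b ∈ Y) ∧ ∀ x ∈ Y, x ∉ X → ∀ p b q, S.link x p b q → b ∈ Y := by
  induction h with
  | done h => exact ⟨h, fun x hx hx' => absurd hx hx'⟩
  | @visit X Y Z a p b q τ₁ τ₂ hl hb h₁ h₂ ih₁ ih₂ =>
    refine ⟨ih₂.1, fun x hx hxX => ?_⟩
    by_cases hxY : x ∈ Y
    · intro p' b' q' hl'
      apply h₂.subset
      by_cases hxb : x = b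
      · subst hxb
        exact ih₁.1 p' b' q' hl'
      · exact ih₁.2 x hxY (by simp [hxb, hxX]) p' b' q' hl'
    · exact ih₂.2 x hx hxY

/-- Induction on the number of unvisited nodes: it drops for the search from the new node `b`, and
also for the continuation at `a`, as visited sets only grow. -/
theorem exists_DFS (hS : ∀ a p b q, S.link a p b q → b ∈ S.nodes) (X : Finset ℕ) (a : ℕ) :
    ∃ τ Y, S.DFS X a τ Y := by
  generalize hk : (S.nodes \ X).card = k
  induction k using Nat.strong_induction_on generalizing X a with
  | _ k ih =>
    subst hk
    by_cases hd : ∀ p b q, S.link a p b q → b ∈ X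
    · exact ⟨[], X, .done hd⟩
    · push Not at hd
      obtain ⟨p, b, q, hl, hb⟩ := hd
      have hlt : ∀ Z, insert b X ⊆ Z → (S.nodes \ Z).card < (S.nodes \ X).card := fun Z hZ => by
        apply Finset.card_lt_card
        rw [Finset.ssubset_iff_of_subset
          (Finset.sdiff_subset_sdiff subset_rfl ((Finset.subset_insert _ _).trans hZ))]
        exact ⟨b, Finset.mem_sdiff.2 ⟨hS _ _ _ _ hl, hb⟩,
          fun h => (Finset.mem_sdiff.1 h).2 (hZ (Finset.mem_insert_self _ _))⟩
      obtain ⟨τ₁, Y, h₁⟩ := ih _ (hlt _ subset_rfl) (insert b X) b rfl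
      obtain ⟨τ₂, Z, h₂⟩ := ih _ (hlt _ h₁.subset) Y a rfl
      exact ⟨_, _, .visit hl hb h₁ h₂⟩

end Snapshot

section

variable {V : Type*} [Fintype V] {G : SimpleGraph V} {L : PortLabelling G} {H m : ℕ} {ν : V ↪ ℕ}
  {pos : Fin m → V} {ident : Fin m → ℕ} {v : V}

theorem link_mem_nodes (a p b q : ℕ) (h : (snapshot L H ν pos ident v).link a p b q) :
    b ∈ (snapshot L H ν pos ident v).nodes := by
  obtain ⟨u, w, -, hw, -, -, rfl, -⟩ := h
  exact Finset.mem_map_of_mem _ (by simpa using hw)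

theorem traversal_length_le (ch : Choices) {a : ℕ} (ha : a ∈ (snapshot L H ν pos ident v).nodes) :
    (ch.traversal (snapshot L H ν pos ident v) a).length ≤ 2 * (Fintype.card V - 1) := by
  obtain ⟨τ, Y, h⟩ := Snapshot.exists_DFS (S := snapshot L H ν pos ident v) link_mem_nodes {a} a
  obtain ⟨Y, h⟩ := ch.traversal_spec _ a ⟨τ, Y, h⟩
  have h1 := h.length
  have hS : ∀ a p b q, (snapshot L H ν pos ident v).link a p b q →
      b ∈ (snapshot L H ν pos ident v).nodes := link_mem_nodes
  have h2 := Finset.card_le_card (h.subset_nodes hS (Finset.singleton_subset_iff.2 ha))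
  have h3 : (snapshot L H ν pos ident v).nodes.card ≤ Fintype.card V := card_nodes_le
  rw [Finset.card_singleton] at h1
  omega

/-- Even a partial snapshot shows true port numbers, so a search from the true location can be
executed in the network and reaches each newly visited node after some prefix. -/
theorem dfs_trip {X Y : Finset ℕ} {a : ℕ} {τ : List ℕ}
    (h : (snapshot L H ν pos ident v).DFS X a τ Y) (u : V) (hu : ν u = a) :
    (∃ π, L.Trip u π u ∧ π.map Prod.fst = τ) ∧
      ∀ x ∈ Y, x ∉ X → ∃ w π ρ, ν w = x ∧ L.Trip u π w ∧ τ = π.map Prod.fst ++ ρ := by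
  induction h generalizing u with
  | done h => exact ⟨⟨[], rfl, rfl⟩, fun x hx hx' => absurd hx hx'⟩
  | @visit X Y Z a p b q τ₁ τ₂ hl hb h₁ h₂ ih₁ ih₂ =>
    subst hu
    obtain ⟨u', w, -, -, huw, e, rfl, hp, hq⟩ := hl
    cases ν.injective e
    obtain ⟨⟨π₁, ht₁, rfl⟩, hv₁⟩ := ih₁ w rfl
    obtain ⟨⟨π₂, ht₂, rfl⟩, hv₂⟩ := ih₂ u rfl
    have hb : L.Trip u ((p, q) :: (π₁ ++ [(q, p)])) u :=
      ⟨w, huw, hp, hq, ht₁.append ⟨u, huw.symm, hq, hp, rfl⟩⟩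
    refine ⟨⟨(p, q) :: (π₁ ++ [(q, p)]) ++ π₂, hb.append ht₂, by simp⟩, fun x hx hxX => ?_⟩
    by_cases hxY : x ∈ Y
    · by_cases hxb : x = ν w
      · exact ⟨w, [(p, q)], π₁.map Prod.fst ++ q :: π₂.map Prod.fst, hxb.symm,
          ⟨w, huw, hp, hq, rfl⟩, by simp⟩
      · obtain ⟨y, π, ρ, hy, hπ, e⟩ := hv₁ x hxY (by simp [hxb, hxX])
        exact ⟨y, (p, q) :: π, ρ ++ q :: π₂.map Prod.fst, hy, ⟨w, huw, hp, hq, hπ⟩, by simp [e]⟩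
    · obtain ⟨y, π, ρ, hy, hπ, e⟩ := hv₂ x hx hxY
      exact ⟨y, _, ρ, hy, hb.append hπ, by simp [e]⟩

/-- The chosen traversal from the true location comes by a node with full view. -/
theorem traversal_full (hG : G.Connected) (hH : G.radius ≤ (H : ℕ∞)) (ch : Choices) :
    ∃ w π ρ, Full G H w ∧ L.Trip v π w ∧
      ch.traversal (snapshot L H ν pos ident v) (ν v) = π.map Prod.fst ++ ρ := by
  obtain ⟨τ, Y, h⟩ := Snapshot.exists_DFS (S := snapshot L H ν pos ident v)
    link_mem_nodes {ν v} (ν v)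
  obtain ⟨Y, h⟩ := ch.traversal_spec _ (ν v) ⟨τ, Y, h⟩
  -- Every node of a walk of length at most `H` ending at `v` lies in the ball around `v`, so all
  -- its edges are visible and closure carries membership in `Y` along the walk.
  have hmem : ∀ (w x : V) (p : G.Walk w x), x = v → p.length ≤ H → ν w ∈ Y := by
    intro w x p
    induction p with
    | nil =>
      rintro rfl -
      exact h.subset (Finset.mem_singleton_self _)
    | @cons a b c hab p ih =>
      rintro rfl hl
      rw [SimpleGraph.Walk.length_cons] at hl
      have hY := ih rfl (by omega)
      have ha : G.edist c a ≤ H := by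
        rw [SimpleGraph.edist_comm]
        refine (SimpleGraph.edist_le (.cons hab p)).trans ?_
        exact_mod_cast hl
      have hb : G.edist c b ≤ H := by
        rw [SimpleGraph.edist_comm]
        refine (SimpleGraph.edist_le p).trans ?_
        exact_mod_cast (by omega : p.length ≤ H)
      have hlink : (snapshot L H ν pos ident c).link (ν b) (L.port b a) (ν a) (L.port a b) :=
        ⟨b, a, hb, ha, hab.symm, rfl, rfl, rfl, rfl⟩
      by_cases hbc : b = c
      · subst hbc
        exact h.closed.1 _ _ _ hlink
      · exact h.closed.2 _ hY (by simpa using fun e => hbc e) _ _ _ hlink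
  obtain ⟨c, hc⟩ := exists_full hG hH
  obtain ⟨p, hp⟩ := hG.exists_walk_length_eq_dist c v
  have hcY := hmem c v p rfl (hp ▸ (full_iff_dist hG).1 hc v)
  by_cases hcv : c = v
  · subst hcv
    exact ⟨c, [], _, hc, rfl, rfl⟩
  · obtain ⟨w, π, ρ, e, ht, e'⟩ := (dfs_trip h v rfl).2 _ hcY (by simpa using hcv)
    cases ν.injective e
    exact ⟨c, π, ρ, hc, ht, e'⟩

theorem true_location_mem_candidates (hG : G.Connected) (hH : G.radius ≤ (H : ℕ∞)) :
    ν v ∈ (snapshot L H ν pos ident v).candidates (deg G v) (idsAt pos ident v) := by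
  have hv : G.edist v v ≤ H := by simp
  refine Finset.mem_filter.2 ⟨Finset.mem_map_of_mem _ (by simp), ?_, snapshot_ids_of_le hv⟩
  refine snapshot_deg_of_le hv fun u hu => ?_
  obtain ⟨c, hc⟩ := exists_full hG hH
  -- All neighbours are visible, and the degree is therefore right, as soon as `H ≥ 1`. If `H = 0`,
  -- the radius is 0 and there are no neighbours.
  rcases Nat.eq_zero_or_pos H with rfl | hpos
  · have : ∀ w, c = w := fun w => by simpa using hc w
    exact absurd ((this v).symm.trans (this u)) hu.ne
  · refine (SimpleGraph.edist_le hu.toWalk).trans ?_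
    exact_mod_cast hpos

end

/-! ### Executions of the H-View-Algorithm, instruction by instruction -/

/-- `Steps ch H o s s'`: in a round with observation `o`, the computation gets from the memory `s`
to the memory `s'`. -/
def Steps (ch : Choices) (H : ℕ) (o : Observation) : Mem → Mem → Prop :=
  Relation.ReflTransGen fun a b => instr ch H o a = .inr b

/-- A finite chain of continuing instructions that ends in an action witnesses that the fixed point
is defined, with this value. -/
theorem hViewCompute_eq {ch : Choices} {H : ℕ} {o : Observation} {s s' s'' : Mem} {a : Action}
    (h : Steps ch H o { s with trail := o.entry.toList ++ s.trail } s')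
    (h' : instr ch H o s' = .inl (s'', a)) :
    hViewCompute ch H s o = ({ s'' with clock := s.clock + 1 }, a) := by
  have hmem : (s'', a) ∈ PFun.fix (fun s' => Part.some (instr ch H o s'))
      { s with trail := o.entry.toList ++ s.trail } := by
    unfold Steps at h
    generalize { s with trail := o.entry.toList ++ s.trail } = s₀ at h
    induction h using Relation.ReflTransGen.head_induction_on with
    | refl => exact PFun.mem_fix_iff.2 (.inl (by simp [h']))
    | head hab _ ih => exact PFun.mem_fix_iff.2 (.inr ⟨_, by simp [hab], ih⟩)
  have hdom := Part.dom_iff_mem.2 ⟨_, hmem⟩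
  simp only [hViewCompute]
  rw [dif_pos hdom, Part.get_eq_of_mem hmem hdom]

section Machine

variable {V : Type*} [Fintype V] {G : SimpleGraph V} (L : PortLabelling G) (H : ℕ) {m : ℕ}
  (A : Team G m) (ch : Choices)

/-- The positions of the robots in round `t`. -/
noncomputable def posAt (t : ℕ) : Fin m → V := (run L H A (hView ch H) t).pos

/-- The snapshot of robot `i` at the node `v` in round `t`. -/
noncomputable def view (i : Fin m) (t : ℕ) (v : V) : Snapshot :=
  snapshot L H (A.naming i) (posAt L H A ch t) (A.idAt t) v

/-- The IDs at the node `v` in round `t`. -/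
noncomputable def idsIn (t : ℕ) (v : V) : Multiset ℕ := idsAt (posAt L H A ch t) (A.idAt t) v

/-- The observation of robot `i` at the node `v` in round `t`, if it has arrived through `e`. -/
noncomputable def look (i : Fin m) (t : ℕ) (v : V) (e : Option ℕ) : Observation :=
  ⟨deg G v, idsIn L H A ch t v, e, view L H A ch i t v⟩

/-- The computation of robot `i` in round `t`, at the node `v` which it has entered through `e`,
gets to the memory `s`. -/
structure Mid (i : Fin m) (t : ℕ) (v : V) (e : Option ℕ) (s : Mem) : Prop where
  active : (run L H A (hView ch H) t).halted i = false
  pos : posAt L H A ch t i = v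
  entry : (run L H A (hView ch H) t).entry i = e
  time : Mem.clock ((run L H A (hView ch H) t).mem i) = t
  clock : s.clock = t
  steps : ∀ s₀ : Mem, s₀ = (run L H A (hView ch H) t).mem i →
    Steps ch H (look L H A ch i t v e) { s₀ with trail := e.toList ++ s₀.trail } s

variable {L H A ch} {i : Fin m} {t : ℕ} {v : V} {e : Option ℕ} {s s' : Mem}

theorem Mid.start (hi : i ∉ A.byz) :
    Mid L H A ch i 0 (A.start i) none ((hView ch H).init (A.ident i)) where
  active := rfl
  pos := if_neg hi
  entry := rfl
  time := rfl
  clock := rfl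
  steps := by
    rintro _ rfl
    exact .refl

theorem Mid.step (h : Mid L H A ch i t v e s)
    (hs : instr ch H (look L H A ch i t v e) s = .inr s') (hc : s'.clock = s.clock := by rfl) :
    Mid L H A ch i t v e s' :=
  { h with clock := hc.trans h.clock, steps := fun s₀ hs₀ => (h.steps s₀ hs₀).tail hs }

theorem Mid.compute_eq (h : Mid L H A ch i t v e s) {a : Action}
    (hs : instr ch H (look L H A ch i t v e) s = .inl (s', a)) :
    (hView ch H).compute ((run L H A (hView ch H) t).mem i)
      (observe L H A t (run L H A (hView ch H) t) i) = ({ s' with clock := t + 1 }, a) := by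
  have hobs : observe L H A t (run L H A (hView ch H) t) i = look L H A ch i t v e := by
    cases h.pos
    cases h.entry
    rfl
  rw [hobs]
  refine (hViewCompute_eq ?_ hs).trans ?_
  · exact h.steps _ rfl
  · rw [h.time]
    rfl

/-- The arrival port already appears in the trail, because the next round records it before its
first instruction. -/
theorem Mid.next (h : Mid L H A ch i t v e s) (hi : i ∉ A.byz) {a : Action}
    (hs : instr ch H (look L H A ch i t v e) s = .inl (s', a)) {w : V} {e' : Option ℕ}
    (ha : (∃ p, a = .move p ∧ L.cross v p = w ∧ L.arrival v p = e') ∨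
      a = .stay ∧ v = w ∧ e' = none) :
    Mid L H A ch i (t + 1) w e'
      { s' with clock := t + 1, trail := e'.toList ++ s'.trail } := by
  have hcomp := h.compute_eq hs
  have hp := h.pos
  unfold posAt at hp
  have hm : (run L H A (hView ch H) (t + 1)).mem i = { s' with clock := t + 1 } := by
    simp only [run, h.active, hcomp]
    rfl
  refine ⟨?_, ?_, ?_, by rw [hm], rfl, ?_⟩
  · simp only [run, h.active, hcomp]
    rcases ha with ⟨p, rfl, -⟩ | ⟨rfl, -⟩ <;> rfl
  · simp only [posAt, run, h.active, hcomp, if_neg hi]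
    rcases ha with ⟨p, rfl, rfl, -⟩ | ⟨rfl, rfl, -⟩ <;> simp [hp]
  · simp only [run, h.active, hcomp]
    rcases ha with ⟨p, rfl, -, rfl⟩ | ⟨rfl, -, rfl⟩ <;> simp [hp]
  · rintro s₀ h₀
    rw [hm] at h₀
    subst h₀
    exact .refl

theorem Mid.stay (h : Mid L H A ch i t v e s) (hi : i ∉ A.byz)
    (hs : instr ch H (look L H A ch i t v e) s = .inl (s', .stay)) :
    Mid L H A ch i (t + 1) v none { s' with clock := t + 1 } :=
  h.next hi hs (.inr ⟨rfl, rfl, rfl⟩)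

theorem Mid.move (h : Mid L H A ch i t v e s) (hi : i ∉ A.byz) {w : V} (hw : G.Adj v w)
    (hs : instr ch H (look L H A ch i t v e) s = .inl (s', .move (L.port v w))) :
    Mid L H A ch i (t + 1) w (some (L.port w v))
      { s' with clock := t + 1, trail := L.port w v :: s'.trail } :=
  h.next hi hs (.inl ⟨_, rfl, PortLabelling.cross_port hw, PortLabelling.arrival_port hw⟩)

theorem Mid.terminate (h : Mid L H A ch i t v e s)
    (hs : instr ch H (look L H A ch i t v e) s = .inl (s', .terminate)) :
    (run L H A (hView ch H) (t + 1)).halted i = true := by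
  have hcomp := h.compute_eq hs
  simp only [run, h.active, hcomp]
  rfl

/-- Walking along a given list of ports. -/
theorem Mid.walk (hi : i ∉ A.byz) {K : List ℕ → Loc}
    (hK : ∀ (o : Observation) (s : Mem) (p : ℕ) (ρ : List ℕ), s.loc = K (p :: ρ) →
      instr ch H o s = .inl ({ s with loc := K ρ }, .move p))
    {π : List (ℕ × ℕ)} {ρ : List ℕ} {w : V} (h : Mid L H A ch i t v e s)
    (hs : s.loc = K (π.map Prod.fst ++ ρ)) (hπ : L.Trip v π w) :
    ∃ e' l, Mid L H A ch i (t + π.length) w e'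
      { s with loc := K ρ, clock := t + π.length, trail := l } := by
  induction π generalizing t v e s with
  | nil =>
    cases hπ
    have h1 := hs
    have h2 := h.clock
    cases s
    simp only [List.map_nil, List.nil_append] at h1
    subst h1 h2
    exact ⟨e, _, h⟩
  | cons a π ih =>
    obtain ⟨u, hu, hp, -, hπ⟩ := hπ
    have h' := h.move hi hu (by rw [hp]; exact hK _ _ _ _ hs)
    obtain ⟨e', l, h''⟩ := ih h' rfl hπ
    refine ⟨e', l, ?_⟩
    rw [List.length_cons, show t + (π.length + 1) = t + 1 + π.length by omega]
    exact h''

/-- Waiting. -/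
theorem Mid.wait (hi : i ∉ A.byz) {d : ℕ}
    (hd : ∀ o c, c < d → instr ch H o { s with clock := c } = .inl ({ s with clock := c }, .stay))
    (h : Mid L H A ch i t v e s) (ht : t ≤ d) :
    ∃ e', Mid L H A ch i d v e' { s with clock := d } := by
  induction d, ht using Nat.le_induction with
  | base =>
    cases h.clock
    exact ⟨e, h⟩
  | succ k hk ih =>
    obtain ⟨e', h'⟩ := ih fun o c hc => hd o c (by omega)
    have h'' := h'.stay hi (hd _ k (by omega))
    exact ⟨none, h''⟩

end Machine

section Impostors

/-! ### Counting impostors -/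

variable {V : Type*} {G : SimpleGraph V} {m : ℕ} {A : Team G m} {i : Fin m} {t : ℕ}

theorem idAt_of_notMem (hi : i ∉ A.byz) : A.idAt t i = A.ident i := if_neg hi

theorem mem_byz_of_idAt_eq (hi : i ∉ A.byz) {j : Fin m} (hj : A.idAt t j = A.ident i)
    (hji : j ≠ i) : j ∈ A.byz := by
  by_contra hb
  rw [idAt_of_notMem hb] at hj
  exact hji (A.ident_inj j hb i hi hj)

variable [Fintype V] {L : PortLabelling G} {H : ℕ} {ch : Choices}

theorem ident_mem_idsIn (hi : i ∉ A.byz) {v : V} (hv : posAt L H A ch t i = v) :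
    A.ident i ∈ idsIn L H A ch t v :=
  mem_idsAt.2 ⟨i, hv, idAt_of_notMem hi⟩

theorem exists_impostor (hi : i ∉ A.byz) {w : V} (hw : posAt L H A ch t i ≠ w)
    (h : A.ident i ∈ idsIn L H A ch t w) :
    ∃ j ∈ A.byz, posAt L H A ch t j = w ∧ A.idAt t j = A.ident i := by
  obtain ⟨j, hj, hid⟩ := mem_idsAt.1 h
  refine ⟨j, mem_byz_of_idAt_eq hi hid ?_, hj, hid⟩
  rintro rfl
  exact hw hj

/-- In each round the Byzantine robots can only show so many IDs of others at so many nodes. -/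
theorem sum_card_impostors_le (L : PortLabelling G) (H : ℕ) (A : Team G m) (ch : Choices) (t : ℕ)
    (q : Fin m → Finset V) (hq : ∀ i ∉ A.byz, ∀ w ∈ q i,
      ∃ j ∈ A.byz, posAt L H A ch t j = w ∧ A.idAt t j = A.ident i) :
    ∑ i ∈ A.byzᶜ, (q i).card ≤ A.byz.card := by
  rw [← Finset.card_sigma]
  refine Finset.card_le_card_of_forall_subsingleton
    (fun p j => posAt L H A ch t j = p.2 ∧ A.idAt t j = A.ident p.1) ?_ ?_
  · rintro ⟨i, w⟩ h
    rw [Finset.mem_sigma, Finset.mem_compl] at h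
    exact hq i h.1 w h.2
  -- One Byzantine robot accounts for one pair only: its ID determines the non-faulty robot and its
  -- position the node.
  · rintro j - ⟨i, w⟩ ⟨h, e, e'⟩ ⟨i', w'⟩ ⟨h', f, f'⟩
    rw [Finset.mem_sigma, Finset.mem_compl] at h h'
    cases A.ident_inj i h.1 i' h'.1 (e'.symm.trans f')
    cases e.symm.trans f
    rfl

theorem card_impostors_le (L : PortLabelling G) (H : ℕ) (ch : Choices) (t : ℕ) (hi : i ∉ A.byz)
    (q : Finset V)
    (hq : ∀ w ∈ q, posAt L H A ch t i ≠ w ∧ A.ident i ∈ idsIn L H A ch t w) :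
    q.card ≤ A.byz.card := by
  refine le_trans ?_ (sum_card_impostors_le L H A ch t (fun j => if j = i then q else ∅) ?_)
  · refine le_trans (by simp) (Finset.single_le_sum
      (f := fun j => (if j = i then q else ∅ : Finset V).card) (fun _ _ => Nat.zero_le _)
      (Finset.mem_compl.2 hi))
  · intro j hj w hw
    by_cases hji : j = i
    · subst hji
      rw [if_pos rfl] at hw
      exact exists_impostor hj (hq w hw).1 (hq w hw).2
    · simp [hji] at hw

end Impostors

/-! ### Find-Lookout -/

section FindLookout

variable {V : Type*} [Fintype V] {G : SimpleGraph V} {L : PortLabelling G} {H m : ℕ}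
  {A : Team G m} {ch : Choices} {i : Fin m} {t : ℕ} {x v : V} {e : Option ℕ} {s : Mem}

/-- What a robot that started at `x` has to remember during Find-Lookout. -/
def Record (L : PortLabelling G) (H m : ℕ) (x : V) (N M : ℕ) (τ : List ℕ) : Prop :=
  N ≤ Fintype.card V ∧ (N = Fintype.card V → M = m ∧ ∃ π u, Full G H u ∧ L.Trip x π u ∧
    τ = π.map Prod.fst ∧ π.length ≤ 2 * (Fintype.card V - 1))

theorem instr_explore (ch : Choices) (H : ℕ) (o : Observation) {todo : List (List ℕ)}
    {ahead taken : List ℕ} (hs : s.loc = .explore todo ahead taken) :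
    ∃ N M τ, (N = o.snap.nodes.card ∧ M = o.snap.robots ∧ τ = taken ∧ s.nmax < N ∨
        N = s.nmax ∧ M = s.mmax ∧ τ = s.τmax ∧ o.snap.nodes.card ≤ N) ∧
      (∀ p rest, ahead = p :: rest → p < o.deg → instr ch H o s = .inl
        ({ s with nmax := N, mmax := M, τmax := τ, loc := .explore todo rest (taken ++ [p]) },
          .move p)) ∧
      (∀ p rest, ahead = p :: rest → ¬ p < o.deg → instr ch H o s = .inr
        { s with nmax := N, mmax := M, τmax := τ, loc := .retreat todo s.trail }) ∧
      (ahead = [] → instr ch H o s = .inr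
        { s with nmax := N, mmax := M, τmax := τ, loc := .retreat todo s.trail }) := by
  by_cases hc : s.nmax < o.snap.nodes.card
  · refine ⟨_, _, _, .inl ⟨rfl, rfl, rfl, hc⟩, ?_, ?_, ?_⟩
    · rintro p rest rfl hp
      simp only [instr, hs, if_pos hc, if_pos hp]
    · rintro p rest rfl hp
      simp only [instr, hs, if_pos hc, if_neg hp]
    · rintro rfl
      simp only [instr, hs, if_pos hc]
  · refine ⟨_, _, _, .inr ⟨rfl, rfl, rfl, not_lt.1 hc⟩, ?_, ?_, ?_⟩
    · rintro p rest rfl hp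
      simp only [instr, hs, if_neg hc, if_pos hp]
    · rintro p rest rfl hp
      simp only [instr, hs, if_neg hc, if_neg hp]
    · rintro rfl
      simp only [instr, hs, if_neg hc]

theorem Mid.retreat (hi : i ∉ A.byz) (h : Mid L H A ch i t v e s) {todo : List (List ℕ)}
    {π : List (ℕ × ℕ)} (hs : s.loc = .retreat todo (π.map Prod.snd).reverse)
    (hπ : L.Trip x π v) :
    ∃ e' l, Mid L H A ch i (t + π.length) x e'
      { s with loc := .retreat todo [], clock := t + π.length, trail := l } := by
  have hr := hπ.reverse
  have e1 : (π.map Prod.snd).reverse = (π.map Prod.swap).reverse.map Prod.fst ++ [] := by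
    simp [Function.comp_def]
  rw [e1] at hs
  have := Mid.walk (K := .retreat todo) hi (fun o s p ρ hs => by simp [instr, hs]) h hs hr
  simpa using this

/-- Recording what is seen at the node `v`, reached along `π`. -/
theorem Record.update {N M N' M' : ℕ} {τ τ' : List ℕ} (h : Record L H m x N M τ)
    {π : List (ℕ × ℕ)} (hπ : L.Trip x π v) (hlen : π.length ≤ 2 * (Fintype.card V - 1))
    (h' : (N' = (view L H A ch i t v).nodes.card ∧ M' = (view L H A ch i t v).robots ∧
        τ' = π.map Prod.fst ∧ N < N') ∨
      (N' = N ∧ M' = M ∧ τ' = τ ∧ (view L H A ch i t v).nodes.card ≤ N')) :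
    Record L H m x N' M' τ' ∧ N ≤ N' ∧ (Full G H v → N' = Fintype.card V) := by
  have hcard : (view L H A ch i t v).nodes.card ≤ Fintype.card V := card_nodes_le
  rcases h' with ⟨rfl, rfl, rfl, hlt⟩ | ⟨rfl, rfl, rfl, hle⟩
  · refine ⟨⟨hcard, fun hN => ?_⟩, hlt.le, fun hv => snapshot_card hv⟩
    have hv : Full G H v := full_of_card_nodes hN.ge
    exact ⟨snapshot_robots hv, π, v, hv, hπ, rfl, hlen⟩
  · refine ⟨h, le_rfl, fun hv => le_antisymm h.1 ?_⟩
    rwa [view, snapshot_card hv] at hle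

/-- One attempted traversal, from the node `v` reached along `π`. -/
theorem Mid.explore (hi : i ∉ A.byz) {todo : List (List ℕ)} {ahead : List ℕ}
    {π : List (ℕ × ℕ)} (h : Mid L H A ch i t v e s)
    (hs : s.loc = .explore todo ahead (π.map Prod.fst)) (htr : s.trail = (π.map Prod.snd).reverse)
    (hπ : L.Trip x π v) (hrec : Record L H m x s.nmax s.mmax s.τmax)
    (hlen : π.length + ahead.length ≤ 2 * (Fintype.card V - 1)) :
    ∃ t' e' N M τ l, t' ≤ t + π.length + 2 * ahead.length ∧
      Mid L H A ch i t' x e' { s with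
        loc := .retreat todo [], clock := t', trail := l, nmax := N, mmax := M, τmax := τ } ∧
      s.nmax ≤ N ∧ Record L H m x N M τ ∧
      ((∃ w ρ σ, Full G H w ∧ L.Trip v ρ w ∧ ahead = ρ.map Prod.fst ++ σ) →
        N = Fintype.card V) := by
  induction ahead generalizing t v e s π with
  | nil =>
    obtain ⟨N, M, τ, hN, -, -, hi3⟩ := instr_explore ch H (look L H A ch i t v e) hs
    obtain ⟨hrec', hle, hfull⟩ := hrec.update hπ (by omega) hN
    obtain ⟨e', l, h'⟩ := (h.step (hi3 rfl)).retreat hi (todo := todo) (by rw [htr]) hπ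
    refine ⟨_, e', N, M, τ, l, by simp, h', hle, hrec', ?_⟩
    rintro ⟨w, _ | ⟨a, ρ⟩, σ, hw, hρ, hσ⟩
    · cases hρ
      exact hfull hw
    · simp at hσ
  | cons p rest ih =>
    obtain ⟨N, M, τ, hN, hi1, hi2, -⟩ := instr_explore ch H (look L H A ch i t v e) hs
    obtain ⟨hrec', hle, hfull⟩ := hrec.update hπ (by omega) hN
    rw [List.length_cons] at hlen
    by_cases hp : p < deg G v
    · obtain ⟨u, hu, rfl⟩ := (PortLabelling.lt_deg_iff (L := L)).1 hp
      obtain ⟨t', e', N', M', τ', l, ht', h', hle', hrec'', hfull'⟩ :=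
        ih (π := π ++ [(L.port v u, L.port u v)]) (h.move hi hu (hi1 _ _ rfl hp)) (by simp)
          (by simp [htr]) (hπ.snoc hu) hrec' (by simp; omega)
      refine ⟨t', e', N', M', τ', l, ?_, h', hle.trans hle', hrec'', ?_⟩
      · simp only [List.length_append, List.length_cons, List.length_nil] at ht' ⊢
        omega
      · rintro ⟨w, _ | ⟨a, ρ⟩, σ, hw, hρ, hσ⟩
        · cases hρ
          exact le_antisymm hrec''.1 ((hfull hw).ge.trans hle')
        · obtain ⟨u', hu', e1, -, hρ⟩ := hρ
          rw [List.map_cons, List.cons_append, List.cons.injEq] at hσ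
          cases PortLabelling.port_injective hu hu' (hσ.1.trans e1.symm)
          exact hfull' ⟨w, ρ, σ, hw, hρ, hσ.2⟩
    · obtain ⟨e', l, h'⟩ := (h.step (hi2 _ _ rfl hp)).retreat hi (todo := todo) (by rw [htr]) hπ
      refine ⟨_, e', N, M, τ, l, by omega, h', hle, hrec', ?_⟩
      rintro ⟨w, _ | ⟨a, ρ⟩, σ, hw, hρ, hσ⟩
      · cases hρ
        exact hfull hw
      · obtain ⟨u', hu', e1, -, hρ⟩ := hρ
        rw [List.map_cons, List.cons_append, List.cons.injEq] at hσ
        exact absurd (PortLabelling.lt_deg_iff.2 ⟨u', hu', e1.trans hσ.1.symm⟩) hp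

/-- All attempted traversals. -/
theorem Mid.explore_all (hi : i ∉ A.byz) {todo : List (List ℕ)} (h : Mid L H A ch i t x e s)
    (hs : s.loc = .retreat todo []) (hrec : Record L H m x s.nmax s.mmax s.τmax)
    (hlen : ∀ τ ∈ todo, τ.length ≤ 2 * (Fintype.card V - 1)) :
    ∃ t' e' N M τ l, t' ≤ t + todo.length * (4 * (Fintype.card V - 1)) ∧
      Mid L H A ch i t' x e' { s with
        loc := .retreat [] [], clock := t', trail := l, nmax := N, mmax := M, τmax := τ } ∧
      s.nmax ≤ N ∧ Record L H m x N M τ ∧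
      ((∃ w ρ σ, Full G H w ∧ L.Trip x ρ w ∧ ρ.map Prod.fst ++ σ ∈ todo) →
        N = Fintype.card V) := by
  induction todo generalizing t e s with
  | nil =>
    refine ⟨t, e, _, _, _, s.trail, by simp, ?_, le_rfl, hrec, by simp⟩
    obtain ⟨me, clock, loc, trail⟩ := s
    cases h.clock
    cases hs
    exact h
  | cons τ₀ todo ih =>
    have hτ₀ := hlen τ₀ List.mem_cons_self
    have hstep : instr ch H (look L H A ch i t x e) s =
        .inr { s with loc := .explore todo τ₀ [], trail := [] } := by
      simp only [instr, hs]
    obtain ⟨t₁, e₁, N₁, M₁, τ₁, l₁, ht₁, h₁, hle₁, hrec₁, hfull₁⟩ :=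
      (h.step hstep).explore (π := []) hi rfl rfl rfl hrec (by simpa using hτ₀)
    obtain ⟨t₂, e₂, N₂, M₂, τ₂, l₂, ht₂, h₂, hle₂, hrec₂, hfull₂⟩ :=
      ih h₁ rfl hrec₁ fun τ hτ => hlen τ (List.mem_cons_of_mem _ hτ)
    refine ⟨t₂, e₂, N₂, M₂, τ₂, l₂, ?_, h₂, hle₁.trans hle₂, hrec₂, ?_⟩
    · rw [List.length_cons, Nat.succ_mul]
      simp only [List.length_nil] at ht₁
      omega
    · rintro ⟨w, ρ, σ, hw, hρ, hσ⟩
      rcases List.mem_cons.1 hσ with hσ | hσ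
      · exact le_antisymm hrec₂.1 ((hfull₁ ⟨w, ρ, σ, hw, hρ, hσ.symm⟩).ge.trans hle₂)
      · exact hfull₂ ⟨w, ρ, σ, hw, hρ, hσ⟩

/-- At the end of Find-Lookout, every robot is at a node with full view and starts to march in
round `(m + 2) n²`. -/
theorem lookout_reached (hG : G.Connected) (hH : G.radius ≤ (H : ℕ∞))
    (hf : 2 * A.byz.card + 1 ≤ m) (hi : i ∉ A.byz) :
    ∃ u e s, Full G H u ∧ Mid L H A ch i ((m + 2) * Fintype.card V ^ 2) u e s ∧
      s.loc = .march ∧ s.me = A.ident i ∧ s.nmax = Fintype.card V ∧ s.mmax = m ∧ s.phase = 1 ∧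
      s.target = none ∧ s.P = (Finset.univ.filter fun w => deg G w = deg G u ∧
        idsIn L H A ch ((m + 2) * Fintype.card V ^ 2) w =
        idsIn L H A ch ((m + 2) * Fintype.card V ^ 2) u).map (A.naming i) := by
  have := hG.nonempty
  have hn : 0 < Fintype.card V := Fintype.card_pos
  set x := A.start i
  set S := view L H A ch i 0 x with hS
  set X := S.candidates (deg G x) (idsIn L H A ch 0 x) with hX
  have h0 : Mid L H A ch i 0 x none _ := .start hi
  have h1 := h0.step (s' := { (hView ch H).init (A.ident i) with
    loc := .retreat ((X.sort (· ≤ ·)).map (ch.traversal S)) [] }) rfl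
  -- A candidate shows the same IDs as the local view, hence the robot's own ID, so every wrong
  -- candidate requires an impostor.
  have hXcard : X.card ≤ A.byz.card + 1 := by
    set q := Finset.univ.filter fun w => x ≠ w ∧ A.ident i ∈ idsIn L H A ch 0 w
    have hq : q.card ≤ A.byz.card := by
      refine card_impostors_le L H ch 0 hi q fun w hw => ?_
      rw [h0.pos]
      exact (Finset.mem_filter.1 hw).2
    have hsub : X ⊆ (insert x q).map (A.naming i) := by
      intro a ha
      obtain ⟨ha, -, hids⟩ := Finset.mem_filter.1 ha
      obtain ⟨w, hw, rfl⟩ := Finset.mem_map.1 ha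
      refine Finset.mem_map_of_mem _ ?_
      rw [Finset.mem_insert]
      refine or_iff_not_imp_left.2 fun hwx => ?_
      refine Finset.mem_filter.2 ⟨Finset.mem_univ _, Ne.symm hwx, ?_⟩
      rw [hS, view, snapshot_ids_of_le (Finset.mem_filter.1 hw).2] at hids
      rw [idsIn, hids]
      exact ident_mem_idsIn hi h0.pos
    calc X.card ≤ _ := Finset.card_le_card hsub
      _ = (insert x q).card := Finset.card_map _
      _ ≤ q.card + 1 := Finset.card_insert_le _ _
      _ ≤ _ := by omega
  obtain ⟨t₁, e₁, N, M, τ, l₁, ht₁, h₁, -, hrec, hfull⟩ := h1.explore_all hi rfl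
    ⟨Nat.zero_le _, fun h => absurd h hn.ne⟩ (by
      intro τ hτ
      obtain ⟨a, ha, rfl⟩ := List.mem_map.1 hτ
      rw [Finset.mem_sort] at ha
      exact traversal_length_le ch (Finset.mem_filter.1 ha).1)
  have hN : N = Fintype.card V := by
    apply hfull
    obtain ⟨w, π, ρ, hw, hπ, e⟩ := traversal_full (L := L) (ν := A.naming i) (v := x)
      (pos := posAt L H A ch 0) (ident := A.idAt 0) hG hH ch
    refine ⟨w, π, ρ, hw, hπ, List.mem_map.2 ⟨A.naming i x, ?_, e⟩⟩
    rw [Finset.mem_sort]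
    exact true_location_mem_candidates hG hH
  obtain ⟨hM, π, u, hu, hπ, rfl, hlen⟩ := hrec.2 hN
  obtain ⟨s₁, h₁, hloc, hme, hnmax, hmmax, hτmax⟩ : ∃ s₁, Mid L H A ch i t₁ x e₁ s₁ ∧
      s₁.loc = .retreat [] [] ∧ s₁.me = A.ident i ∧ s₁.nmax = Fintype.card V ∧ s₁.mmax = m ∧
      s₁.τmax = π.map Prod.fst := ⟨_, h₁, rfl, rfl, hN, hM, rfl⟩
  have h₂ := h₁.step (s' := { s₁ with loc := .approach s₁.τmax }) (by simp only [instr, hloc])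
  obtain ⟨e₃, l₃, h₃⟩ := h₂.walk (K := .approach) (ρ := []) hi
    (fun o s p ρ hs => by simp only [instr, hs]) (by simp [hτmax]) hπ
  have h₄ := h₃.step (s' := { s₁ with
    loc := .lookout, clock := t₁ + π.length, trail := l₃ }) (by simp only [instr])
  -- An attempt costs at most 4(n - 1) rounds out and back, and twice the number of attempts is at
  -- most 2(f + 1) ≤ m + 1. With the final walk of at most 2(n - 1) steps the total is at most (m +
  -- 2)·2(n - 1), and 2(n - 1) ≤ n².
  have htime : t₁ + π.length ≤ (m + 2) * Fintype.card V ^ 2 := by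
    rw [List.length_map, Finset.length_sort] at ht₁
    have e1 : X.card * (4 * (Fintype.card V - 1)) ≤ (m + 1) * (2 * (Fintype.card V - 1)) := by
      calc X.card * (4 * (Fintype.card V - 1)) = (2 * X.card) * (2 * (Fintype.card V - 1)) := by ring
        _ ≤ _ := Nat.mul_le_mul_right _ (by omega)
    have e2 : 2 * (Fintype.card V - 1) ≤ Fintype.card V ^ 2 := by
      obtain ⟨k, hk⟩ := Nat.exists_eq_add_of_le hn
      rw [hk, show 0 + 1 + k - 1 = k by omega]
      nlinarith
    have e3 := Nat.mul_le_mul_left (m + 2) e2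
    have e4 : (m + 2) * (2 * (Fintype.card V - 1)) =
      (m + 1) * (2 * (Fintype.card V - 1)) + 2 * (Fintype.card V - 1) := by ring
    omega
  obtain ⟨e₅, h₅⟩ := h₄.wait hi (d := (m + 2) * Fintype.card V ^ 2) (fun o c hc => by
    simp only [instr, hnmax, hmmax, if_pos hc]) htime
  refine ⟨u, e₅, _, hu, h₅.step (s' := { s₁ with
    loc := .march, clock := (m + 2) * Fintype.card V ^ 2, trail := l₃, target := none, phase := 1
    P := (view L H A ch i ((m + 2) * Fintype.card V ^ 2) u).candidates (deg G u)
      (idsIn L H A ch ((m + 2) * Fintype.card V ^ 2) u) })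
      (by simp only [instr, hnmax, hmmax, lt_irrefl, if_false]; rfl),
    rfl, hme, hnmax, hmmax, rfl, rfl, snapshot_candidates hu u⟩

end FindLookout

/-! ### March and Merge for a single robot -/

section Phases

variable {V : Type*} [Fintype V] {G : SimpleGraph V} (L : PortLabelling G) (H : ℕ) {m : ℕ}
  (A : Team G m) (ch : Choices)

/-- In round `t`, robot `i` is at the node `x` and at the program location `loc`; its candidate
locations are the nodes of `Q`, and it has reached phase `ph`. -/
structure Ready (i : Fin m) (t : ℕ) (x : V) (e : Option ℕ) (s : Mem) (loc : Loc) (Q : Finset V)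
    (ph : ℕ) (tgt : Option V) : Prop where
  mid : Mid L H A ch i t x e s
  loc : s.loc = loc
  me : s.me = A.ident i
  nmax : s.nmax = Fintype.card V
  mmax : s.mmax = m
  phase : s.phase = ph
  P : s.P = Q.map (A.naming i)
  target : s.target = tgt.map (A.naming i)

variable {L H A ch} {i : Fin m} {t ph : ℕ} {x : V} {e : Option ℕ} {s : Mem} {Q : Finset V}
  {tgt : Option V}

/-! ### March-to-Center -/

theorem instr_marchWatch (ch : Choices) (H : ℕ) {o : Observation} {s : Mem}
    (hs : s.loc = .marchWatch) {R : Finset ℕ} (hR : (s.P.filter fun a => s.me ∈ o.snap.ids a) = R) :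
    instr ch H o s = if s.clock < s.deadline then .inl ({ s with P := R }, .stay)
      else .inr { s with P := R, loc := .marchEnd } := by
  subst hR
  simp only [instr, hs]

theorem Ready.march_move (hG : G.Connected) (hH : G.radius ≤ (H : ℕ∞)) (hi : i ∉ A.byz)
    (hx : Full G H x) (h : Ready L H A ch i t x e s .march {x} ph tgt) :
    ∃ d ∈ centerNodes G, ∃ e' s', Ready L H A ch i (t + H) d e' s' .marchEnd {d} ph tgt := by
  have hfirst : ch.first s.P = A.naming i x := by
    have := ch.first_spec s.P (by simp [h.P])
    simpa [h.P] using this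
  obtain ⟨d, hd, hdest⟩ : ∃ d ∈ centerNodes G,
      ch.closest (view L H A ch i t x) (A.naming i x) = A.naming i d := closest_mem hG ch hx _
  obtain ⟨hπ, hlen⟩ : L.Trip x (ch.path (view L H A ch i t x) (A.naming i x) (A.naming i d)) d ∧
      (ch.path (view L H A ch i t x) (A.naming i x) (A.naming i d)).length ≤ H :=
    path_trip hG ch hx (full_of_mem_centerNodes hG hH hd) x
  set π := ch.path (view L H A ch i t x) (A.naming i x) (A.naming i d) with hπdef
  have hcard : s.P.card = 1 := by simp [h.P]
  have h₁ := h.mid.step (s' := { s with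
      deadline := t + H, loc := .marchMove (A.naming i d) (π.map Prod.fst) }) (by
    simp only [instr, h.loc, hcard, if_true, look, hfirst, hdest, h.mid.clock, hπdef])
  obtain ⟨e₂, l₂, h₂⟩ := h₁.walk (K := .marchMove (A.naming i d)) (ρ := []) hi
    (fun o s p ρ hs => by simp only [instr, hs]) (by simp) hπ
  obtain ⟨e₃, h₃⟩ := h₂.wait hi (d := t + H) (fun o c hc => by
    simp only [instr, if_pos hc]) (by omega)
  refine ⟨d, hd, e₃, _, ⟨h₃.step (s' := { s with
    deadline := t + H, loc := .marchEnd, P := {A.naming i d}, clock := t + H, trail := l₂ }) (by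
      simp only [instr, lt_irrefl, if_false]), rfl, h.me, h.nmax, h.mmax, h.phase, ?_, h.target⟩⟩
  simp

/-- The true location survives because the robot itself shows its ID there. Only the last filtering
matters later: it happens in round `t + H`, the very round in which the target is chosen, so
impostors and duplicates are counted simultaneously. -/
theorem Ready.march_watch (hi : i ∉ A.byz) (hx : Full G H x) (hxQ : x ∈ Q) (hQ : Q.card ≠ 1)
    (h : Ready L H A ch i t x e s .march Q ph tgt) :
    ∃ Q' ⊆ Q, x ∈ Q' ∧ (∀ w ∈ Q', A.ident i ∈ idsIn L H A ch (t + H) w) ∧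
      ∃ e' s', Ready L H A ch i (t + H) x e' s' .marchEnd Q' ph tgt := by
  have h₁ := h.mid.step (s' := { s with deadline := t + H, loc := .marchWatch }) (by
    simp only [instr, h.loc, h.P, Finset.card_map, hQ, if_false, h.mid.clock])
  have hfilter : ∀ (k : ℕ) (R : Finset V),
      ((R.map (A.naming i)).filter fun a => s.me ∈ (view L H A ch i k x).ids a) =
        (R.filter fun w => A.ident i ∈ idsIn L H A ch k w).map (A.naming i) := by
    intro k R
    rw [Finset.filter_map]
    congr 1
    refine Finset.filter_congr fun w _ => ?_
    simp only [Function.comp_apply, view, snapshot_ids hx, h.me, idsIn]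
  have key : ∀ k ≤ H, ∃ R ⊆ Q, x ∈ R ∧ ∃ e', Mid L H A ch i (t + k) x e' { s with
      deadline := t + H, loc := .marchWatch, P := R.map (A.naming i), clock := t + k } := by
    intro k
    induction k with
    | zero =>
      refine fun _ => ⟨Q, subset_rfl, hxQ, e, ?_⟩
      have h₂ := h₁
      have hP := h.P
      have hc := h.mid.clock
      cases s
      cases hP
      cases hc
      exact h₂
    | succ k ih =>
      intro hk
      obtain ⟨R, hR, hxR, e', h'⟩ := ih (by omega)
      refine ⟨R.filter fun w => A.ident i ∈ idsIn L H A ch (t + k) w,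
        (Finset.filter_subset _ _).trans hR,
        Finset.mem_filter.2 ⟨hxR, ident_mem_idsIn hi h'.pos⟩, none, ?_⟩
      have h'' := h'.stay hi (s' := { s with
        deadline := t + H, loc := .marchWatch, clock := t + k
        P := (R.filter fun w => A.ident i ∈ idsIn L H A ch (t + k) w).map (A.naming i) }) 
          ((instr_marchWatch ch H rfl (hfilter _ _)).trans (if_pos (by simp only; omega)))
      exact h''
  obtain ⟨R, hR, hxR, e', h'⟩ := key H le_rfl
  refine ⟨R.filter fun w => A.ident i ∈ idsIn L H A ch (t + H) w,
    (Finset.filter_subset _ _).trans hR,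
    Finset.mem_filter.2 ⟨hxR, ident_mem_idsIn hi h'.pos⟩,
    fun w hw => (Finset.mem_filter.1 hw).2, e', _, ⟨h'.step (s' := { s with
      deadline := t + H, loc := .marchEnd, clock := t + H
      P := (R.filter fun w => A.ident i ∈ idsIn L H A ch (t + H) w).map (A.naming i) }) 
        ((instr_marchWatch ch H rfl (hfilter _ _)).trans (if_neg (lt_irrefl _))),
      rfl, h.me, h.nmax, h.mmax, h.phase, rfl, h.target⟩⟩

/-- One execution of March-to-Center by one robot. -/
theorem Ready.march (hG : G.Connected) (hH : G.radius ≤ (H : ℕ∞)) (hi : i ∉ A.byz)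
    (hx : Full G H x) (hxQ : x ∈ Q) (h : Ready L H A ch i t x e s .march Q ph tgt) :
    ∃ x' Q', Full G H x' ∧ x' ∈ Q' ∧ Q'.card ≤ Q.card ∧
      (Q.card = 1 → x' ∈ centerNodes G) ∧
      (Q.card ≠ 1 → ∀ w ∈ Q', A.ident i ∈ idsIn L H A ch (t + H) w) ∧
      ∃ e' s', Ready L H A ch i (t + H) x' e' s' .marchEnd Q' ph tgt := by
  by_cases hQ : Q.card = 1
  · obtain ⟨y, rfl⟩ := Finset.card_eq_one.1 hQ
    cases Finset.mem_singleton.1 hxQ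
    obtain ⟨d, hd, h'⟩ := h.march_move hG hH hi hx
    exact ⟨d, {d}, full_of_mem_centerNodes hG hH hd, Finset.mem_singleton_self _, by simp,
      fun _ => hd, fun h => absurd hQ h, h'⟩
  · obtain ⟨Q', hsub, hxQ', hids, h'⟩ := h.march_watch hi hx hxQ hQ
    exact ⟨x, Q', hx, hxQ', Finset.card_le_card hsub, fun h => absurd h hQ, fun _ => hids, h'⟩

theorem Ready.march_again (h : Ready L H A ch i t x e s .marchEnd Q ph tgt)
    (ht : (view L H A ch i t x).target = none) :
    ∃ s', Ready L H A ch i t x e s' .march Q (ph + 1) none :=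
  ⟨_, h.mid.step (s' := { s with target := none, phase := s.phase + 1, loc := .march }) (by
    simp only [instr, h.loc, look, ht, if_true]),
    rfl, h.me, h.nmax, h.mmax, congrArg (· + 1) h.phase, h.P, rfl⟩

theorem Ready.march_done (h : Ready L H A ch i t x e s .marchEnd Q ph tgt) {c : V}
    (ht : (view L H A ch i t x).target = some (A.naming i c)) :
    ∃ s', Ready L H A ch i t x e s' (.merge false) Q (ph + 1) (some c) :=
  ⟨_, h.mid.step (s' := { s with
    target := some (A.naming i c), phase := s.phase + 1, loc := .merge false }) (by
      simp only [instr, h.loc, look, ht, reduceCtorEq, if_false]),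
    rfl, h.me, h.nmax, h.mmax, congrArg (· + 1) h.phase, h.P, rfl⟩

/-! ### Merge -/

theorem instr_mergeMove_mismatch (ch : Choices) (H : ℕ) {o : Observation} {s : Mem} {fin : Bool}
    {a : ℕ} {expect : Option ℕ} {ahead : List (ℕ × ℕ)}
    (hs : s.loc = .mergeMove fin a expect ahead) (hm : expect ≠ none ∧ o.entry ≠ expect) :
    instr ch H o s = .inr { s with loc := .mergeStuck fin, P := s.P.erase a } := by
  simp only [instr, hs]
  exact if_pos hm

theorem instr_mergeMove_nil (ch : Choices) (H : ℕ) {o : Observation} {s : Mem} {fin : Bool}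
    {a : ℕ} {expect : Option ℕ} (hs : s.loc = .mergeMove fin a expect [])
    (hm : ¬ (expect ≠ none ∧ o.entry ≠ expect)) :
    instr ch H o s = .inr { s with loc := .mergeCheck fin a } := by
  simp only [instr, hs]
  exact if_neg hm

theorem instr_mergeMove_cons (ch : Choices) (H : ℕ) {o : Observation} {s : Mem} {fin : Bool}
    {a p q : ℕ} {expect : Option ℕ} {rest : List (ℕ × ℕ)}
    (hs : s.loc = .mergeMove fin a expect ((p, q) :: rest))
    (hm : ¬ (expect ≠ none ∧ o.entry ≠ expect)) :
    instr ch H o s = if p < o.deg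
      then .inl ({ s with loc := .mergeMove fin a (some q) rest }, .move p)
      else .inr { s with loc := .mergeStuck fin, P := s.P.erase a } := by
  simp only [instr, hs]
  exact if_neg hm

/-- Here `π` is the part already walked since the start `x`. The actual walk is kept even after a
failure, since the reversal needs it. -/
theorem Mid.merge_walk (hi : i ∉ A.byz) {fin : Bool} {a : ℕ} {expect : Option ℕ}
    {ahead π : List (ℕ × ℕ)} {v : V} (h : Mid L H A ch i t v e s)
    (hs : s.loc = .mergeMove fin a expect ahead) (htr : s.trail = (π.map Prod.snd).reverse)
    (hπ : L.Trip x π v) :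
    ∃ t' y π' e', t ≤ t' ∧ t' ≤ t + ahead.length ∧ L.Trip x π' y ∧
      π'.length ≤ π.length + ahead.length ∧
      (Mid L H A ch i t' y e' { s with
          loc := .mergeStuck fin, clock := t', trail := (π'.map Prod.snd).reverse
          P := s.P.erase a } ∧ ¬ ((expect = none ∨ e = expect) ∧ ∃ w, L.Trip v ahead w) ∨
        Mid L H A ch i t' y e' { s with
          loc := .mergeCheck fin a, clock := t', trail := (π'.map Prod.snd).reverse } ∧
          (expect = none ∨ e = expect) ∧ L.Trip v ahead y) := by
  have hclock := h.clock
  by_cases hm : expect ≠ none ∧ e ≠ expect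
  · refine ⟨t, v, π, e, le_rfl, by omega, hπ, by omega, .inl ⟨h.step ?_ hclock.symm, ?_⟩⟩
    · rw [← htr, ← hclock]
      exact instr_mergeMove_mismatch ch H hs hm
    · rintro ⟨h1 | h1, -⟩
      · exact hm.1 h1
      · exact hm.2 h1
  · have hm' : expect = none ∨ e = expect := by
      by_contra hcon
      exact hm (not_or.1 hcon)
    induction ahead generalizing t v e s π expect with
    | nil =>
      refine ⟨t, v, π, e, le_rfl, by simp, hπ, by simp, .inr ⟨h.step ?_ hclock.symm, hm', rfl⟩⟩
      rw [← htr, ← hclock]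
      exact instr_mergeMove_nil ch H hs hm
    | cons b rest ih =>
      obtain ⟨p, q⟩ := b
      by_cases hp : p < deg G v
      · obtain ⟨u, hu, rfl⟩ := (PortLabelling.lt_deg_iff (L := L)).1 hp
        have hmv := h.move hi hu (s' := { s with loc := .mergeMove fin a (some q) rest }) 
          ((instr_mergeMove_cons ch H hs hm).trans (if_pos hp))
        have hπ' := hπ.snoc hu
        by_cases hq : L.port u v = q
        · subst hq
          obtain ⟨t', y, π', e', ht, ht', hy, hlen, hor⟩ := ih hmv rfl
            (by simp [htr]) hπ' rfl (by simp) (.inr rfl)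
          refine ⟨t', y, π', e', by omega, ?_, hy, ?_, ?_⟩
          · rw [List.length_cons]; omega
          · rw [List.length_append, List.length_singleton] at hlen
            rw [List.length_cons]; omega
          · rcases hor with ⟨h', hno⟩ | ⟨h', -, hyes⟩
            · refine .inl ⟨h', ?_⟩
              rintro ⟨-, w, u', hu', e1, -, hw⟩
              cases PortLabelling.port_injective hu' hu e1
              exact hno ⟨.inr rfl, w, hw⟩
            · exact .inr ⟨h', hm', u, hu, rfl, rfl, hyes⟩
        -- A wrong arrival port is noticed only after the move, so this move belongs to the walk to
        -- be reversed.
        · refine ⟨t + 1, u, _, _, by omega, by simp, hπ', by simp,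
            .inl ⟨hmv.step ?_, ?_⟩⟩
          · rw [List.map_append, List.reverse_append, ← htr]
            exact instr_mergeMove_mismatch ch H rfl ⟨Option.some_ne_none q, by simpa [look] using hq⟩
          · rintro ⟨-, w, u', hu', e1, e2, -⟩
            cases PortLabelling.port_injective hu' hu e1
            exact hq e2
      · refine ⟨t, v, π, e, le_rfl, by simp, hπ, by simp, .inl ⟨h.step ?_ hclock.symm, ?_⟩⟩
        · rw [← htr, ← hclock]
          exact (instr_mergeMove_cons ch H hs hm).trans (if_neg hp)
        · rintro ⟨-, w, u, hu, e1, -⟩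
          exact hp ((PortLabelling.lt_deg_iff (L := L)).2 ⟨u, hu, e1⟩)

/-- The waiting time at the end of a Merge, if the path has been followed to the node `y`. -/
theorem Mid.merge_check (hi : i ∉ A.byz) {fin : Bool} {a d : ℕ} {y c : V}
    (h : Mid L H A ch i t y e s) (hs : s.loc = .mergeCheck fin a) (hd : s.deadline = d)
    (htd : t ≤ d) (hc : Full G H c) (hme : s.me = A.ident i) (hn : s.nmax = Fintype.card V)
    (htgt : s.target = some (A.naming i c)) :
    ∃ e' P', Mid L H A ch i d y e' { s with loc := .mergeEnd fin, clock := d, P := P' } ∧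
      (P' = s.P.erase a ∨ P' = s.P ∧ A.ident i ∈ idsIn L H A ch d c ∧
        idsIn L H A ch d c = idsIn L H A ch d y) ∧ (y = c → P' = s.P) := by
  set bad : ℕ → Prop := fun k => (view L H A ch i k y).nodes.card < s.nmax ∨
    s.me ∉ (view L H A ch i k y).ids (A.naming i c) ∨
    (view L H A ch i k y).deg (A.naming i c) ≠ deg G y ∨
    (view L H A ch i k y).ids (A.naming i c) ≠ idsIn L H A ch k y with hbad
  have good : ∀ k, ¬ bad k → A.ident i ∈ idsIn L H A ch k c ∧
      idsIn L H A ch k c = idsIn L H A ch k y := by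
    intro k hk
    simp only [hbad, not_or, not_not, not_lt, hn, hme] at hk
    have hy : Full G H y := full_of_card_nodes hk.1
    have hids : (view L H A ch i k y).ids (A.naming i c) = idsIn L H A ch k c := snapshot_ids hy
    rw [hids] at hk
    exact ⟨hk.2.1, hk.2.2.2⟩
  have pass : ∀ k, y = c → posAt L H A ch k i = y → ¬ bad k := by
    rintro k rfl hpos
    have hids : (view L H A ch i k y).ids (A.naming i y) = idsIn L H A ch k y := snapshot_ids hc
    have hdeg : (view L H A ch i k y).deg (A.naming i y) = deg G y := snapshot_deg hc
    have hcard : (view L H A ch i k y).nodes.card = Fintype.card V := snapshot_card hc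
    simp only [hbad, not_or, not_not, not_lt, hn, hme, hids, hdeg, hcard]
    exact ⟨le_rfl, ident_mem_idsIn hi hpos, trivial, trivial⟩
  -- Failing the check in several rounds has the same effect as failing once.
  have upd : ∀ (k : ℕ) (R : Finset ℕ), R = s.P ∨ R = s.P.erase a →
      ((if bad k then R.erase a else R) = s.P ∨ (if bad k then R.erase a else R) = s.P.erase a) ∧
      (bad k → (if bad k then R.erase a else R) = s.P.erase a) := by
    rintro k R (rfl | rfl) <;> by_cases hk : bad k <;> simp [hk]
  have hi_cont : ∀ (k : ℕ) (e' : Option ℕ) (R : Finset ℕ), k < d →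
      instr ch H (look L H A ch i k y e')
        { s with loc := .mergeCheck fin a, clock := k, P := R } =
      .inl ({ s with loc := .mergeCheck fin a, clock := k
                     P := if bad k then R.erase a else R }, .stay) := by
    intro k e' R hk
    by_cases hb : bad k
    · simp only [if_pos hb]
      simp only [hbad] at hb
      simp only [instr, look, htgt, Option.getD_some]
      rw [if_pos hb]
      simp only [hd, if_pos hk]
    · simp only [if_neg hb]
      simp only [hbad] at hb
      simp only [instr, look, htgt, Option.getD_some]
      rw [if_neg hb]
      simp only [hd, if_pos hk]
  have hi_end : ∀ (e' : Option ℕ) (R : Finset ℕ),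
      instr ch H (look L H A ch i d y e')
        { s with loc := .mergeCheck fin a, clock := d, P := R } =
      .inr { s with loc := .mergeEnd fin, clock := d, P := if bad d then R.erase a else R } := by
    intro e' R
    by_cases hb : bad d
    · simp only [if_pos hb]
      simp only [hbad] at hb
      simp only [instr, look, htgt, Option.getD_some]
      rw [if_pos hb]
      simp only [hd, lt_irrefl, if_false]
    · simp only [if_neg hb]
      simp only [hbad] at hb
      simp only [instr, look, htgt, Option.getD_some]
      rw [if_neg hb]
      simp only [hd, lt_irrefl, if_false]
  have key : ∀ k, t ≤ k → k ≤ d → ∃ e' R, Mid L H A ch i k y e'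
      { s with loc := .mergeCheck fin a, clock := k, P := R } ∧
      (R = s.P ∨ R = s.P.erase a) ∧ (y = c → R = s.P) := by
    intro k htk
    induction k, htk using Nat.le_induction with
    | base =>
      refine fun _ => ⟨e, s.P, ?_, .inl rfl, fun _ => rfl⟩
      rw [← hs]
      have hc := h.clock
      cases s
      cases hc
      exact h
    | succ k hk ih =>
      intro hkd
      obtain ⟨e', R, h', hR, hyc⟩ := ih (by omega)
      refine ⟨none, _, h'.stay hi (hi_cont k e' R (by omega)), (upd k R hR).1, fun hy => ?_⟩
      rw [if_neg (pass k hy h'.pos)]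
      exact hyc hy
  obtain ⟨e', R, h', hR, hyc⟩ := key d htd le_rfl
  refine ⟨e', _, h'.step (hi_end e' R), ?_, fun hy => ?_⟩
  · by_cases hb : bad d
    · exact .inl ((upd d R hR).2 hb)
    · rw [if_neg hb]
      exact hR.symm.imp id fun h => ⟨h, good d hb⟩
  · rw [if_neg (pass d hy h'.pos)]
    exact hyc hy

/-- One execution of Merge by one robot. Its final position is `y`. -/
theorem Ready.merge (hG : G.Connected) (hH : G.radius ≤ (H : ℕ∞)) (hi : i ∉ A.byz) {fin : Bool}
    {c : V} (hc : c ∈ centerNodes G) (hx : Full G H x) (hxQ : x ∈ Q)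
    (h : Ready L H A ch i t x e s (.merge fin) Q ph (some c)) :
    ∃ y π Q' e' s', L.Trip x π y ∧ π.length ≤ H ∧
      Ready L H A ch i (t + H) y e' s' (.mergeEnd fin) Q' ph (some c) ∧
      s'.trail = (π.map Prod.snd).reverse ∧ x ∈ Q' ∧
      (ch.first (Q.map (A.naming i)) = A.naming i x → y = c ∧ Q' = Q) ∧
      (ch.first (Q.map (A.naming i)) ≠ A.naming i x → Q'.card < Q.card ∨
        Q' = Q ∧ y ≠ c ∧ A.ident i ∈ idsIn L H A ch (t + H) c ∧
          idsIn L H A ch (t + H) c = idsIn L H A ch (t + H) y) := by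
  have hcF := full_of_mem_centerNodes hG hH hc
  obtain ⟨w, hwQ, hw⟩ := Finset.mem_map.1
    (ch.first_spec (Q.map (A.naming i)) ⟨_, Finset.mem_map_of_mem _ hxQ⟩)
  rw [← hw]
  obtain ⟨hρ, hlen⟩ : L.Trip w (ch.path (view L H A ch i t x) (A.naming i w) (A.naming i c)) c ∧
      (ch.path (view L H A ch i t x) (A.naming i w) (A.naming i c)).length ≤ H :=
    path_trip hG ch hx hcF w
  set ρ := ch.path (view L H A ch i t x) (A.naming i w) (A.naming i c) with hρdef
  have htgt : s.target = some (A.naming i c) := h.target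
  have h₁ := h.mid.step (s' := { s with
      deadline := t + H, trail := [], loc := .mergeMove fin (A.naming i w) none ρ }) (by
    simp only [instr, h.loc, look, htgt, Option.getD_some, h.P, ← hw, h.mid.clock, hρdef])
  obtain ⟨t', y, π, e', -, ht', hπ, hπlen, hor⟩ :=
    h₁.merge_walk (x := x) (π := []) hi rfl rfl rfl
  have herase : s.P.erase (A.naming i w) = (Q.erase w).map (A.naming i) := by
    rw [h.P, Finset.map_erase]
  have hcard : (Q.erase w).card < Q.card := Finset.card_erase_lt_of_mem hwQ
  rw [List.length_nil, zero_add] at hπlen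
  rcases hor with ⟨h', hno⟩ | ⟨h', -, hyes⟩
  · have hwx : w ≠ x := by
      rintro rfl
      exact hno ⟨.inl rfl, c, hρ⟩
    obtain ⟨e'', h''⟩ := h'.wait hi (d := t + H) (fun o k hk => by
      simp only [instr, if_pos hk]) (by omega)
    refine ⟨y, π, Q.erase w, e'', _, hπ, hπlen.trans hlen, ⟨h''.step (s' := { s with
        deadline := t + H, trail := (π.map Prod.snd).reverse, clock := t + H
        P := s.P.erase (A.naming i w), loc := .mergeEnd fin }) (by
          simp only [instr, lt_irrefl, if_false]), rfl, h.me, h.nmax, h.mmax, h.phase, herase,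
        h.target⟩, rfl, Finset.mem_erase.2 ⟨hwx.symm, hxQ⟩, ?_, fun _ => .inl hcard⟩
    exact fun heq => absurd ((A.naming i).injective heq) hwx
  · obtain ⟨e'', P', h'', hP', hgood⟩ := h'.merge_check hi rfl rfl (by simp only; omega) hcF
      h.me h.nmax htgt
    by_cases hwx : w = x
    · subst hwx
      have hyc : y = c := hyes.unique hρ
      refine ⟨y, π, Q, e'', _, hπ, hπlen.trans hlen, ⟨h'', rfl, h.me, h.nmax, h.mmax, h.phase,
        (hgood hyc).trans h.P, h.target⟩, rfl, hxQ, fun _ => ⟨hyc, rfl⟩, fun hne => absurd rfl hne⟩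
    · have hyc : y ≠ c := by
        rintro rfl
        exact hwx (hρ.unique_left hyes)
      rcases hP' with hP' | ⟨hP', hids⟩
      · refine ⟨y, π, Q.erase w, e'', _, hπ, hπlen.trans hlen, ⟨h'', rfl, h.me, h.nmax, h.mmax,
          h.phase, hP'.trans herase, h.target⟩, rfl, Finset.mem_erase.2 ⟨Ne.symm hwx, hxQ⟩,
          fun heq => absurd ((A.naming i).injective heq) hwx, fun _ => .inl hcard⟩
      · exact ⟨y, π, Q, e'', _, hπ, hπlen.trans hlen, ⟨h'', rfl, h.me, h.nmax, h.mmax,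
          h.phase, hP'.trans h.P, h.target⟩, rfl, hxQ,
          fun heq => absurd ((A.naming i).injective heq) hwx, fun _ => .inr ⟨rfl, hyc, hids⟩⟩

/-- The reversal of a Merge. -/
theorem Ready.reverse (hi : i ∉ A.byz) {y : V} {π : List (ℕ × ℕ)}
    (h : Ready L H A ch i t y e s (.mergeEnd false) Q ph tgt)
    (hπ : L.Trip x π y) (hlen : π.length ≤ H) (htr : s.trail = (π.map Prod.snd).reverse) :
    ∃ e' s', Ready L H A ch i (t + H) x e' s' (.merge (decide (ph + 1 > (m + 1) / 2))) Q (ph + 1)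
      tgt := by
  have hr := hπ.reverse
  have h₁ := h.mid.step (s' := { s with loc := .reverse s.trail, deadline := t + H }) (by
    simp only [instr, h.loc, h.mid.clock])
  obtain ⟨e₂, l₂, h₂⟩ := h₁.walk (K := .reverse) (ρ := []) hi
    (fun o s p ρ hs => by simp only [instr, hs]) (by simp [htr, Function.comp_def]) hr
  obtain ⟨e₃, h₃⟩ := h₂.wait hi (d := t + H) (fun o c hc => by
    simp only [instr, if_pos hc]) (by simpa using hlen)
  refine ⟨e₃, _, ⟨h₃.step (s' := { s with
    loc := .merge (decide (ph + 1 > (m + 1) / 2)), deadline := t + H, clock := t + H, trail := l₂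
    phase := ph + 1 }) ?_, rfl, h.me, h.nmax, h.mmax, rfl, h.P, h.target⟩⟩
  simp only [instr, lt_irrefl, if_false, h.phase, h.mmax]
  by_cases hph : ph + 1 > (m + 1) / 2 <;> simp [hph]

theorem Ready.terminate (h : Ready L H A ch i t x e s (.mergeEnd true) Q ph tgt) :
    (run L H A (hView ch H) (t + 1)).halted i = true :=
  h.mid.terminate (s' := s) (by simp only [instr, h.loc])

end Phases

section Team

variable {V : Type*} {G : SimpleGraph V} {m : ℕ} {A : Team G m} {ch : Choices} {x : Fin m → V}
  {Q Q' : Fin m → Finset V}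

/-! ### The whole team -/

/-- The number of wrong candidate locations of all non-faulty robots. -/
def excess (A : Team G m) (Q : Fin m → Finset V) : ℕ := ∑ i ∈ A.byzᶜ, ((Q i).card - 1)

/-- All non-faulty robots try their true location first. -/
def AllTrue (A : Team G m) (ch : Choices) (x : Fin m → V) (Q : Fin m → Finset V) : Prop :=
  ∀ i ∉ A.byz, ch.first ((Q i).map (A.naming i)) = A.naming i (x i)

theorem AllTrue.of_excess (hx : ∀ i ∉ A.byz, x i ∈ Q i) (h : excess A Q = 0) :
    AllTrue A ch x Q := by
  intro i hi
  have hcard : (Q i).card - 1 = 0 := Finset.sum_eq_zero_iff.1 h i (Finset.mem_compl.2 hi)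
  obtain ⟨w, hw, e⟩ := Finset.mem_map.1 (ch.first_spec ((Q i).map (A.naming i))
    ⟨_, Finset.mem_map_of_mem _ (hx i hi)⟩)
  rw [← e, Finset.card_le_one.1 (by omega) w hw (x i) (hx i hi)]

theorem excess_mono (h : ∀ i ∉ A.byz, (Q' i).card ≤ (Q i).card) : excess A Q' ≤ excess A Q :=
  Finset.sum_le_sum fun i hi => Nat.sub_le_sub_right (h i (Finset.mem_compl.1 hi)) 1

variable [Fintype V] {L : PortLabelling G} {H : ℕ} {t ph : ℕ}

/-- In round `t` every non-faulty robot `i` is at the node `x i` with full view and at the program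
location `loc`, with candidate locations `Q i`. -/
def Stage (L : PortLabelling G) (H : ℕ) (A : Team G m) (ch : Choices) (t : ℕ) (loc : Loc)
    (x : Fin m → V) (Q : Fin m → Finset V) (ph : ℕ) (tgt : Option V) : Prop :=
  ∀ i ∉ A.byz, Full G H (x i) ∧ x i ∈ Q i ∧
    ∃ e s, Ready L H A ch i t (x i) e s loc (Q i) ph tgt

/-- Impostors are charged twice over: a robot of `M` contributes its duplicate, wherever it is, and
any other robot contributes each of its wrong candidates. `M = ∅` gives the initial bound on the
excess; `M` nonempty is used when a march yields no target. -/
theorem excess_add_card_le (M : Finset (Fin m))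
    (hM : ∀ i ∈ M, i ∉ A.byz ∧ (Q i).card = 1 ∧ ∃ j ∈ A.byz, A.idAt t j = A.ident i)
    (hQ : ∀ i ∉ A.byz, i ∉ M → posAt L H A ch t i = x i ∧ x i ∈ Q i ∧
      ∀ w ∈ Q i, A.ident i ∈ idsIn L H A ch t w) :
    excess A Q + M.card ≤ A.byz.card := by
  choose! j hj using fun i hi => (hM i hi).2.2
  refine le_trans (le_of_eq ?_) (sum_card_impostors_le L H A ch t
    (fun i => if i ∈ M then {posAt L H A ch t (j i)} else (Q i).erase (x i)) ?_)
  · have hcard : M.card = ∑ i ∈ A.byzᶜ, if i ∈ M then 1 else 0 := by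
      rw [Finset.sum_ite_mem, Finset.inter_eq_right.2, Finset.card_eq_sum_ones]
      exact fun i hi => Finset.mem_compl.2 (hM i hi).1
    rw [excess, hcard, ← Finset.sum_add_distrib]
    refine Finset.sum_congr rfl fun i hi => ?_
    by_cases hiM : i ∈ M
    · simp [hiM, (hM i hiM).2.1]
    · rw [if_neg hiM, if_neg hiM,
        Finset.card_erase_of_mem (hQ i (Finset.mem_compl.1 hi) hiM).2.1, add_zero]
  · intro i hi w hw
    by_cases hiM : i ∈ M
    · rw [if_pos hiM, Finset.mem_singleton] at hw
      exact ⟨j i, (hj i hiM).1, hw.symm, (hj i hiM).2⟩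
    · rw [if_neg hiM, Finset.mem_erase] at hw
      obtain ⟨hpos, -, hids⟩ := hQ i hi hiM
      exact exists_impostor hi (hpos ▸ hw.1.symm) (hids w hw.2)

theorem stage_start (hG : G.Connected) (hH : G.radius ≤ (H : ℕ∞)) (L : PortLabelling G)
    (A : Team G m) (ch : Choices) (hf : 2 * A.byz.card + 1 ≤ m) :
    ∃ x Q, Stage L H A ch ((m + 2) * Fintype.card V ^ 2) .march x Q 1 none ∧
      excess A Q ≤ A.byz.card := by
  have := hG.nonempty
  have : Nonempty Mem := ⟨(hView ch H).init 0⟩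
  choose! x e s hx hmid hloc hme hnmax hmmax hph htgt hP using
    fun i hi => lookout_reached (L := L) (ch := ch) (i := i) hG hH hf hi
  set t := (m + 2) * Fintype.card V ^ 2
  refine ⟨x, fun i => Finset.univ.filter fun w => deg G w = deg G (x i) ∧
    idsIn L H A ch t w = idsIn L H A ch t (x i), fun i hi => ⟨hx i hi, by simp, e i, s i,
      ⟨hmid i hi, hloc i hi, hme i hi, hnmax i hi, hmmax i hi, hph i hi, hP i hi, htgt i hi⟩⟩, ?_⟩
  refine excess_add_card_le (L := L) (H := H) (ch := ch) (t := t) (x := x) ∅ (by simp)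
    fun i hi _ => ⟨(hmid i hi).pos, by simp, fun w hw => ?_⟩
  rw [(Finset.mem_filter.1 hw).2.2]
  exact ident_mem_idsIn hi (hmid i hi).pos

/-- The first loop: March-to-Center until there is a target. -/
theorem march_loop (hG : G.Connected) (hH : G.radius ≤ (H : ℕ∞))
    (hf : A.byz.card + 1 ≤ A.byzᶜ.card) {k : ℕ} (hS : Stage L H A ch t .march x Q (k + 1) none)
    (hk : excess A Q + k ≤ A.byz.card) :
    ∃ K x' Q', ∃ c ∈ centerNodes G, k < K ∧
      Stage L H A ch (t + H * (K - k)) (.merge false) x' Q' (K + 1) (some c) ∧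
      excess A Q' + K ≤ A.byz.card + 1 := by
  have := hG.nonempty
  generalize hd : A.byz.card - k = d
  induction d generalizing t x Q k with
  | zero | succ d ih =>
    choose! x' Q' hx' hxQ' hcard hcenter hids hready using
      fun i hi => (hS i hi).2.2.elim fun e h => h.elim fun s h =>
        h.march hG hH hi (hS i hi).1 (hS i hi).2.1
    have hpos : ∀ i ∉ A.byz, posAt L H A ch (t + H) i = x' i := fun i hi =>
      (hready i hi).elim fun e h => h.elim fun s h => h.mid.pos
    rcases target_dichotomy hG L H (posAt L H A ch (t + H)) (A.idAt (t + H)) with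
      ⟨hnone, hdup⟩ | ⟨c, hc, hsome⟩
    · set M := A.byzᶜ.filter fun i => (Q i).card = 1 with hM
      have hM' : excess A Q' + M.card ≤ A.byz.card := by
        refine excess_add_card_le (L := L) (H := H) (ch := ch) (t := t + H) (x := x') M ?_ ?_
        · intro i hi
          obtain ⟨hi, hQi⟩ := Finset.mem_filter.1 hi
          rw [Finset.mem_compl] at hi
          refine ⟨hi, le_antisymm ((hcard i hi).trans hQi.le)
            (Finset.card_pos.2 ⟨_, hxQ' i hi⟩), ?_⟩
          obtain ⟨j, hji, hid⟩ := hdup i ((hpos i hi).symm ▸ hcenter i hi hQi)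
          rw [idAt_of_notMem hi] at hid
          exact ⟨j, mem_byz_of_idAt_eq hi hid hji, hid⟩
        · intro i hi hiM
          refine ⟨hpos i hi, hxQ' i hi, hids i hi fun hQi => hiM ?_⟩
          exact Finset.mem_filter.2 ⟨Finset.mem_compl.2 hi, hQi⟩
      -- A robot outside `M` has at least one wrong candidate. With `hM'` and `hf`, the excess must
      -- have decreased strictly.
      have hMcard : A.byzᶜ.card ≤ excess A Q + M.card := by
        rw [excess, hM, Finset.card_filter, ← Finset.sum_add_distrib, Finset.card_eq_sum_ones]
        refine Finset.sum_le_sum fun i hi => ?_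
        have : 0 < (Q i).card := Finset.card_pos.2 ⟨_, (hS i (Finset.mem_compl.1 hi)).2.1⟩
        split_ifs <;> omega
      -- If `A.byz.card - k = 0`, then the old excess is 0, so all non-faulty robots are in `M` and
      -- there are too few Byzantine robots to duplicate their IDs. This contradiction ends the base
      -- case; otherwise one more march follows.
      first
      | omega
      | have hS' : Stage L H A ch (t + H) .march x' Q' (k + 1 + 1) none := by
          intro i hi
          obtain ⟨e, s, h⟩ := hready i hi
          obtain ⟨s', h'⟩ := h.march_again (hnone _ _ (hx' i hi))
          exact ⟨hx' i hi, hxQ' i hi, e, s', h'⟩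
        obtain ⟨K, x'', Q'', c, hc, hK, hS'', hle⟩ := ih hS' (by omega) (by omega)
        refine ⟨K, x'', Q'', c, hc, by omega, ?_, hle⟩
        have e1 : t + H * (K - k) = t + H + H * (K - (k + 1)) := by
          rw [show K - k = K - (k + 1) + 1 by omega, Nat.mul_succ]
          omega
        rwa [e1]
    · refine ⟨k + 1, x', Q', c, hc, by omega, ?_, ?_⟩
      · intro i hi
        obtain ⟨e, s, h⟩ := hready i hi
        obtain ⟨s', h'⟩ := h.march_done (hsome _ _ (hx' i hi))
        refine ⟨hx' i hi, hxQ' i hi, e, s', ?_⟩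
        rwa [show t + H * (k + 1 - k) = t + H by simp]
      · have := excess_mono (A := A) hcard
        omega

/-- One execution of Merge by the team: either all robots get together, or the number of wrong
candidate locations decreases. -/
theorem Stage.merge (hG : G.Connected) (hH : G.radius ≤ (H : ℕ∞))
    (hf : A.byz.card + 1 ≤ A.byzᶜ.card) {fin : Bool} {c : V} (hc : c ∈ centerNodes G)
    (hS : Stage L H A ch t (.merge fin) x Q ph (some c)) :
    ∃ (y : Fin m → V) (Q' : Fin m → Finset V),
      (∀ i ∉ A.byz, x i ∈ Q' i ∧ ∃ π e s, L.Trip (x i) π (y i) ∧ π.length ≤ H ∧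
        Ready L H A ch i (t + H) (y i) e s (.mergeEnd fin) (Q' i) ph (some c) ∧
        s.trail = (π.map Prod.snd).reverse) ∧
      (AllTrue A ch x Q → ∀ i ∉ A.byz, y i = c ∧ Q' i = Q i) ∧
      (¬ AllTrue A ch x Q → excess A Q' < excess A Q) := by
  have := hG.nonempty
  have : Nonempty Mem := ⟨(hView ch H).init 0⟩
  choose! y π Q' e s hπ hlen hready htr hxQ' htrue hfalse using
    fun i hi => (hS i hi).2.2.elim fun e h => h.elim fun s h =>
      h.merge hG hH hi hc (hS i hi).1 (hS i hi).2.1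
  refine ⟨y, Q', fun i hi => ⟨hxQ' i hi, π i, e i, s i, hπ i hi, hlen i hi, hready i hi, htr i hi⟩,
    fun h i hi => htrue i hi (h i hi), fun hnot => ?_⟩
  have hle : ∀ i ∉ A.byz, (Q' i).card ≤ (Q i).card := by
    intro i hi
    by_cases h : ch.first ((Q i).map (A.naming i)) = A.naming i (x i)
    · rw [(htrue i hi h).2]
    · rcases hfalse i hi h with h | ⟨h, -⟩
      · exact h.le
      · rw [h]
  by_cases hlt : ∃ i ∉ A.byz, (Q' i).card < (Q i).card
  · obtain ⟨i, hi, hlt⟩ := hlt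
    have hpos : 0 < (Q' i).card := Finset.card_pos.2 ⟨_, hxQ' i hi⟩
    exact Finset.sum_lt_sum
      (fun i hi => Nat.sub_le_sub_right (hle i (Finset.mem_compl.1 hi)) 1)
      ⟨i, Finset.mem_compl.2 hi, by omega⟩
  -- Nobody has discarded a candidate, although some robot `b` tried a wrong one. Robots that tried
  -- their true location are at `c` and have an impostor at `y b`; the others have one at `c`. That
  -- makes more impostors than Byzantine robots.
  · exfalso
    push Not at hlt
    unfold AllTrue at hnot
    push Not at hnot
    obtain ⟨b, hb, hbfalse⟩ := hnot
    obtain ⟨-, hyb, -, hyb'⟩ := (hfalse b hb hbfalse).resolve_left (not_lt.2 (hlt b hb))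
    have := sum_card_impostors_le L H A ch (t + H) (fun i =>
      if ch.first ((Q i).map (A.naming i)) = A.naming i (x i) then {y b} else {c}) (by
        intro i hi w hw
        have hpos := (hready i hi).mid.pos
        by_cases h : ch.first ((Q i).map (A.naming i)) = A.naming i (x i)
        · rw [if_pos h, Finset.mem_singleton] at hw
          subst hw
          rw [(htrue i hi h).1] at hpos
          refine exists_impostor hi (by rw [hpos]; exact hyb.symm) ?_
          rw [← hyb']
          exact ident_mem_idsIn hi hpos
        · rw [if_neg h, Finset.mem_singleton] at hw
          subst hw
          obtain ⟨-, hy, hmem, -⟩ := (hfalse i hi h).resolve_left (not_lt.2 (hlt i hi))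
          exact exists_impostor hi (by rwa [hpos]) hmem)
    have hone : ∀ i ∈ A.byzᶜ, (if ch.first ((Q i).map (A.naming i)) = A.naming i (x i)
        then {y b} else {c} : Finset V).card = 1 := fun i _ => by split_ifs <;> simp
    rw [Finset.sum_congr rfl hone, ← Finset.card_eq_sum_ones] at this
    omega

/-- The second loop: Merge and its reversal. -/
theorem merge_loop (hG : G.Connected) (hH : G.radius ≤ (H : ℕ∞))
    (hf : A.byz.card + 1 ≤ A.byzᶜ.card) {c : V} (hc : c ∈ centerNodes G) {r : ℕ}
    (hS : Stage L H A ch t (.merge false) x Q ph (some c))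
    (hr : r = max 1 ((m + 1) / 2 + 1 - ph)) (hQ : AllTrue A ch x Q ∨ excess A Q ≤ r) :
    ∃ Q' ph', Stage L H A ch (t + 2 * H * r) (.merge true) x Q' ph' (some c) ∧
      AllTrue A ch x Q' := by
  induction r generalizing t ph Q with
  | zero => omega
  | succ r ih =>
    obtain ⟨y, Q', hend, htrue, hfalse⟩ := hS.merge hG hH hf hc
    have hS' : Stage L H A ch (t + 2 * H) (.merge (decide (ph + 1 > (m + 1) / 2))) x Q' (ph + 1)
        (some c) := by
      intro i hi
      obtain ⟨hxQ', π, e, s, hπ, hlen, hready, htr⟩ := hend i hi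
      obtain ⟨e', s', h'⟩ := hready.reverse hi hπ hlen htr
      refine ⟨(hS i hi).1, hxQ', e', s', ?_⟩
      rwa [show t + 2 * H = t + H + H by omega]
    have hQ' : AllTrue A ch x Q' ∨ excess A Q' ≤ r := by
      by_cases h : AllTrue A ch x Q
      · left
        intro i hi
        rw [(htrue h i hi).2]
        exact h i hi
      · have h1 := hfalse h
        have h2 := hQ.resolve_left h
        exact .inr (by omega)
    by_cases hph : ph + 1 > (m + 1) / 2
    · rw [decide_eq_true hph] at hS'
      obtain rfl : r = 0 := by omega
      refine ⟨Q', ph + 1, by simpa using hS', hQ'.elim id fun h => ?_⟩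
      exact .of_excess (fun i hi => (hend i hi).1) (by omega)
    · rw [decide_eq_false hph] at hS'
      obtain ⟨Q'', ph'', hS'', h''⟩ := ih hS' (by omega) hQ'
      refine ⟨Q'', ph'', ?_, h''⟩
      rwa [show t + 2 * H * (r + 1) = t + 2 * H + 2 * H * r by ring]

/-- There are `K` marches of `H` rounds, then max(1, ⌈m/2⌉ - K) Merges of `2 * H` rounds with their
reversals, then one Merge of `H` rounds. The bound on `K` and the sufficiency of the Merges both
come from f + 1 ≤ ⌈m/2⌉. -/
theorem gathering (hG : G.Connected) (hH : G.radius ≤ (H : ℕ∞)) (L : PortLabelling G)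
    (A : Team G m) (ch : Choices) (hf : A.byz.card + 1 ≤ A.byzᶜ.card) :
    ∃ K, 1 ≤ K ∧ K ≤ (m + 1) / 2 ∧ GatheredInRound L H A (hView ch H)
      ((m + 2) * Fintype.card V ^ 2 + H * (K + 2 * max 1 ((m + 1) / 2 - K) + 1)) := by
  have hm : 2 * A.byz.card + 1 ≤ m := by
    have := A.byz.card_add_card_compl
    rw [Fintype.card_fin] at this
    omega
  obtain ⟨x, Q, hS, hQ⟩ := stage_start hG hH L A ch hm
  obtain ⟨K, x', Q', c, hc, hK, hS', hQ'⟩ := march_loop hG hH hf (k := 0) hS hQ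
  obtain ⟨Q'', ph, hS'', htrue⟩ := merge_loop hG hH hf hc hS' (r := max 1 ((m + 1) / 2 - K))
    (by omega) (.inr (by omega))
  obtain ⟨y, Q₃, hend, hall, -⟩ := hS''.merge hG hH hf hc
  refine ⟨K, hK, by omega, c, fun i hi => ?_⟩
  obtain ⟨-, π, e, s, -, -, hready, -⟩ := hend i hi
  have ht : (m + 2) * Fintype.card V ^ 2 + H * (K + 2 * max 1 ((m + 1) / 2 - K) + 1) =
      (m + 2) * Fintype.card V ^ 2 + H * (K - 0) + 2 * H * max 1 ((m + 1) / 2 - K) + H := by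
    rw [Nat.sub_zero]
    ring
  rw [ht]
  exact ⟨hready.mid.active, hready.terminate, hready.mid.pos.trans (hall htrue i hi).1⟩

end Team

end ByzGather

/-! ### The running time -/

theorem theorem2 {V : Type*} [Fintype V] (G : SimpleGraph V) (hG : G.Connected)
    (L : ByzGather.PortLabelling G) (n m f H : ℕ) (hn : Fintype.card V = n)
    (hH : G.radius ≤ (H : ℕ∞)) (A : ByzGather.Team G m)
    (hbyz : A.byz.card = f) (hgood : f + 1 ≤ (A.byzᶜ).card) (ch : ByzGather.Choices) :
    ∃ T : ℕ, ByzGather.GatheredInRound L H A (ByzGather.hView ch H) T ∧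
      T ≤ (m + 2) * n ^ 2 + H * max (2 * ((m + 1) / 2)) ((m + 1) / 2 + 3) ∧
      (Even m → 6 ≤ m → T ≤ (m + 2) * n ^ 2 + H * m) ∧
      (H ≤ n → T ≤ 7 * (m * n ^ 2)) := by
  subst hn hbyz
  have hm : 1 ≤ m := by
    have := A.byz.card_add_card_compl
    rw [Fintype.card_fin] at this
    omega
  obtain ⟨K, hK, hK', hT⟩ := ByzGather.gathering hG hH L A ch hgood
  -- For K < ⌈m/2⌉ the left side is 2⌈m/2⌉ - K + 1, largest at K = 1; for K = ⌈m/2⌉ it is ⌈m/2⌉ + 3.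
  have hle : K + 2 * max 1 ((m + 1) / 2 - K) + 1 ≤
      max (2 * ((m + 1) / 2)) ((m + 1) / 2 + 3) := by omega
  have hbound := Nat.add_le_add_left (Nat.mul_le_mul_left H hle) ((m + 2) * Fintype.card V ^ 2)
  refine ⟨_, hT, hbound, fun hev hm6 => ?_, fun hHn => hbound.trans ?_⟩
  · rwa [show max (2 * ((m + 1) / 2)) ((m + 1) / 2 + 3) = m by
      obtain ⟨k, rfl⟩ := hev
      omega] at hbound
  -- The bound 6m - 2 is what remains of 7m after m + 2; it is attained at m = 1, where both sides
  -- are 4.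
  · have h1 : max (2 * ((m + 1) / 2)) ((m + 1) / 2 + 3) ≤ 6 * m - 2 := by omega
    have h2 : H ≤ Fintype.card V ^ 2 := hHn.trans (Nat.le_self_pow two_ne_zero _)
    calc _ ≤ (m + 2) * Fintype.card V ^ 2 + Fintype.card V ^ 2 * (6 * m - 2) :=
          Nat.add_le_add_left (Nat.mul_le_mul h2 h1) _
      _ = (m + 2 + (6 * m - 2)) * Fintype.card V ^ 2 := by ring
      _ = 7 * (m * Fintype.card V ^ 2) := by
          rw [show m + 2 + (6 * m - 2) = 7 * m by omega, mul_assoc]
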